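/- Let $\mathcal A=(a_i)_{i\in I}$ be a point configuration in $\mathbb R^d$, that is, a finite family of points (repetitions allowed) whose affine hull is $\mathbb R^d$. Subconfigurations are nonempty sets $F\subseteq I$ of labels, $\operatorname{conv}F$ denotes $\operatorname{conv}\{a_i: i\in F\}$, and a face of $F$ is $F$ itself or the set of labels of $F$ whose points lie on a supporting hyperplane of $\operatorname{conv}F$. A subdivision of $\mathcal A$ is a collection $\Sigma$ of subconfigurations that is closed under taking faces, with $\bigcup_{F\in\Sigma}\operatorname{conv}F=\operatorname{conv}\mathcal A$ and $\operatorname{relint}\operatorname{conv}F\cap\operatorname{relint}\operatorname{conv}F'=\emptyset$ for distinct $F,F'\in\Sigma$. It refines $\Sigma'$ if each $F\in\Sigma$ is contained in some $F'\in\Sigma'$. The trivial subdivision consists of all faces of $I$. A nontrivial subdivision is coarsest if the only subdivisions it refines are itself and the trivial one. A $k$-split is a coarsest subdivision with exactly $k$ maximal faces that has a face of codimension $k-1$ not contained in the boundary of $\operatorname{conv}\mathcal A$. For a weight function $w:I\to\mathbb R$, let $\Sigma_w(\mathcal A)$ be the regular subdivision, whose faces are the sets $\{i:(w(i),a_i)\in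 B\}$ for the nonempty bounded faces $B$ of $\operatorname{conv}\{(w(i),a_i)\}+\mathbb R_{\ge0}(1,0,\dots,0)\subset\mathbb R\times\mathbb R^d$, and let $$\mathcal E_w(\mathcal A)=\{x\in\mathbb R\times\mathbb R^d:\langle(1,a_i),x\rangle\ge -w(i)\ \text{for all } i\in I\}$$ be its envelope. A decomposition $w=\sum_j w_j$ into finitely many weight functions is coherent if $\mathcal E_w(\mathcal A)=\sum_j\mathcal E_{w_j}(\mathcal A)$ (Minkowski sum). Call $w$ split prime if $\Sigma_w(\mathcal A)$ refines no $1$-split and no $2$-split. For $p\in I$ let $S^p$ be the collection of faces of $I\setminus\{p\}$ and let $w_p$ be $1$ at $p$ and $0$ elsewhere. For each $2$-split $S$ fix one of its two maximal faces, $S_+$, call the other $S_-$, let $H_S$ be the affine span of the points with labels in $S_+\cap S_-$, and put $w_S(i)=\operatorname{dist}(a_i,H_S)$ for $i\in S_+$ and $w_S(i)=0$ for $i\notin S_+$. Theorem (Split Decomposition Theorem for Point Configurations). Every weight function $w:I\to\mathbb R$ has a coherent decomposition $$w=w_0+\sum_{p:\ S^p\text{ is a }1\text{-split}}\lambda_p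 w_p+\sum_{S\text{ a }2\text{-split}}\lambda_S w_S$$ with all $\lambda_p,\lambda_S\ge0$ and $w_0$ split prime, and $w_0$, $(\lambda_p)$, $(\lambda_S)$ are uniquely determined by these properties. -/

import Mathlib

open scoped Pointwise

noncomputable section

namespace PointConfig

/-! A point configuration in `ℝ^d` is a finite family `a : ι → ℝ^d`, so that repeated points are
distinguished by their labels; subconfigurations are sets of labels. -/

variable {d : ℕ} {ι : Type*}

/-- `F` is a (nonempty) face of the subconfiguration `G`: the points of `G` on some hyperplane
`⟪u, x⟫ = c` that supports `conv G`. The case `u = 0`, `c = 0` makes `G` a face of itself. -/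
def IsFace (a : ι → EuclideanSpace ℝ (Fin d)) (F G : Set ι) : Prop :=
  F.Nonempty ∧ ∃ (u : EuclideanSpace ℝ (Fin d)) (c : ℝ),
    (∀ i ∈ G, c ≤ inner ℝ u (a i)) ∧ F = {i ∈ G | inner ℝ u (a i) = c}

/-- The convex hull of the points of a subconfiguration. -/
def hull (a : ι → EuclideanSpace ℝ (Fin d)) (F : Set ι) : Set (EuclideanSpace ℝ (Fin d)) :=
  convexHull ℝ (a '' F)

/-- Subdivisions of a point configuration, as collections of nonempty subconfigurations. -/
structure IsSubdivision (a : ι → EuclideanSpace ℝ (Fin d)) (S : Set (Set ι)) : Prop where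
  nonempty : ∀ F ∈ S, F.Nonempty
  face_mem : ∀ F ∈ S, ∀ F', IsFace a F' F → F' ∈ S
  cover : hull a Set.univ = ⋃ F ∈ S, hull a F
  disjoint : ∀ F ∈ S, ∀ F' ∈ S, F ≠ F' →
    intrinsicInterior ℝ (hull a F) ∩ intrinsicInterior ℝ (hull a F') = ∅

/-- The trivial subdivision: the whole configuration and all its faces. -/
def trivialSubdivision (a : ι → EuclideanSpace ℝ (Fin d)) : Set (Set ι) :=
  {F | IsFace a F Set.univ}

/-- `S` is a refinement of `T`. -/
def Refines (S T : Set (Set ι)) : Prop :=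
  ∀ F ∈ S, ∃ G ∈ T, F ⊆ G

/-- A coarsest subdivision: nontrivial, and properly coarsened only by the trivial subdivision. -/
def IsCoarsest (a : ι → EuclideanSpace ℝ (Fin d)) (S : Set (Set ι)) : Prop :=
  IsSubdivision a S ∧ S ≠ trivialSubdivision a ∧
    ∀ T, IsSubdivision a T → Refines S T → T = S ∨ T = trivialSubdivision a

/-- The inclusion-maximal faces of a subdivision. -/
def maximalFaces (S : Set (Set ι)) : Set (Set ι) :=
  {F | Maximal (· ∈ S) F}

/-- `F` is not entirely contained in the boundary of the convex hull of the configuration. -/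
def IsInterior (a : ι → EuclideanSpace ℝ (Fin d)) (F : Set ι) : Prop :=
  ¬ hull a F ⊆ frontier (hull a Set.univ)

/-- A `k`-split (`k ≥ 1`) of a `d`-dimensional configuration: a coarsest subdivision with `k`
maximal faces that has an interior face of codimension `k - 1`. -/
def IsKSplit (a : ι → EuclideanSpace ℝ (Fin d)) (k : ℕ) (S : Set (Set ι)) : Prop :=
  IsCoarsest a S ∧ (maximalFaces S).ncard = k ∧
    ∃ F ∈ S, IsInterior a F ∧ Module.finrank ℝ (vectorSpan ℝ (a '' F)) + k = d + 1

/-- The lifted polyhedron of a weight function, in `ℝ × ℝ^d`. -/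
def lift (a : ι → EuclideanSpace ℝ (Fin d)) (w : ι → ℝ) : Set (ℝ × EuclideanSpace ℝ (Fin d)) :=
  convexHull ℝ (Set.range fun i => (w i, a i)) +
    (fun t : ℝ => (t, (0 : EuclideanSpace ℝ (Fin d)))) '' Set.Ici 0

/-- The regular subdivision of a weight function, given by the bounded (equivalently, lower) faces
of the lifted polyhedron. -/
def regularSubdivision (a : ι → EuclideanSpace ℝ (Fin d)) (w : ι → ℝ) : Set (Set ι) :=
  {F | ∃ B : Set (ℝ × EuclideanSpace ℝ (Fin d)), B.Nonempty ∧ IsExposed ℝ (lift a w) B ∧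
    Bornology.IsBounded B ∧ F = {i | (w i, a i) ∈ B}}

/-- The envelope of the configuration with respect to a weight function. -/
def envelope (a : ι → EuclideanSpace ℝ (Fin d)) (w : ι → ℝ) :
    Set (ℝ × EuclideanSpace ℝ (Fin d)) :=
  {x | ∀ i, -w i ≤ x.1 + inner ℝ (a i) x.2}

/-- The collection `S^p` with the unique maximal face `A ∖ {p}`. -/
def pointSplit (a : ι → EuclideanSpace ℝ (Fin d)) (p : ι) : Set (Set ι) :=
  {F | IsFace a F {p}ᶜ}

/-- The labels `p` for which `S^p` is a `1`-split. -/
abbrev OneSplit (a : ι → EuclideanSpace ℝ (Fin d)) : Type _ :=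
  {p : ι // IsKSplit a 1 (pointSplit a p)}

/-- The `2`-splits of a configuration. -/
abbrev TwoSplit (a : ι → EuclideanSpace ℝ (Fin d)) : Type _ :=
  {S : Set (Set ι) // IsKSplit a 2 S}

instance [Finite ι] (a : ι → EuclideanSpace ℝ (Fin d)) : Fintype (OneSplit a) :=
  Fintype.ofFinite _

instance [Finite ι] (a : ι → EuclideanSpace ℝ (Fin d)) : Fintype (TwoSplit a) :=
  Fintype.ofFinite _

/-- The weight function `w_p` of the `1`-split `S^p`: it is `1` at `p` and `0` elsewhere. -/
def pointWeight (p : ι) : ι → ℝ :=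
  Set.indicator {p} 1

/-- The hyperplane of a `2`-split, spanned by the points common to its maximal faces. -/
def splitHyperplane (a : ι → EuclideanSpace ℝ (Fin d)) (S : Set (Set ι)) :
    AffineSubspace ℝ (EuclideanSpace ℝ (Fin d)) :=
  affineSpan ℝ (a '' ⋂₀ maximalFaces S)

/-- The weight function `w_S` of a `2`-split `S` with chosen positive side `P`, one of its two
maximal faces: the distance to the split hyperplane on `P`, and `0` on the other side. -/
def splitWeight (a : ι → EuclideanSpace ℝ (Fin d)) (S : Set (Set ι)) (P : Set ι) : ι → ℝ :=
  P.indicator fun i => Metric.infDist (a i) (splitHyperplane a S)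

/-- `w` is split prime: its regular subdivision refines no `1`-split and no `2`-split. -/
def SplitPrime (a : ι → EuclideanSpace ℝ (Fin d)) (w : ι → ℝ) : Prop :=
  ∀ S, IsKSplit a 1 S ∨ IsKSplit a 2 S → ¬ Refines (regularSubdivision a w) S

/-- `w = w₀ + ∑ lam p • w_p + ∑ mu S • w_S` is a coherent decomposition into `1`-splits, `2`-splits
and a split prime weight function, where `side S` is the positive side of the `2`-split `S`. The
last clause is coherence: the envelope of the sum is the Minkowski sum of the envelopes. -/
structure IsSplitDecomposition [Finite ι] (a : ι → EuclideanSpace ℝ (Fin d))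
    (side : TwoSplit a → Set ι) (w w₀ : ι → ℝ) (lam : OneSplit a → ℝ) (mu : TwoSplit a → ℝ) :
    Prop where
  lam_nonneg : ∀ p, 0 ≤ lam p
  mu_nonneg : ∀ S, 0 ≤ mu S
  prime : SplitPrime a w₀
  sum_eq : w = w₀ + ∑ p, lam p • pointWeight p.1 + ∑ S, mu S • splitWeight a S.1 (side S)
  coherent : envelope a w = envelope a w₀ + ∑ p, envelope a (lam p • pointWeight p.1) +
    ∑ S, envelope a (mu S • splitWeight a S.1 (side S))

end PointConfig

end

/-! A point of the envelope is an affine minorant of the weight, and its tight labels form a cell of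
the regular subdivision. The vertices of the envelope belong to the spanning cells and generate it
up to the recession cone `envelope a 0` (`envelope_subset_of_convex`). In a coherent sum each cell
lies in a cell of either summand (`exists_tight_subset_of_coherent`).

Refining no `1`-split amounts to `Full`. A `2`-split is given by a normalized affine functional `h`:
its maximal faces are the labels on the two closed sides, and its weight is the positive part of
`h`. Refining no `2`-split thus means that every split hyperplane is crossed by a cell
(`splitPrime_iff`). Both conditions pass to coherent summands.

Existence: the lower hull `v` of `w` has the same envelope, and `w - v` is supported on labels of
`1`-splits, whose weights only contribute the recession cone. If no cell crosses `h = 0`, every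
vertex `x` of the envelope is tight on one closed side only and splits as `x + 0` or `(x - c • h) +
c • h`. The largest admissible `c` makes a label beyond the hyperplane tight, and the remainder
crosses (`exists_coherent_crosses`). Splits are subtracted one after another.

Uniqueness: without the `1`-split terms, the sum is the lower hull of `w`, hence determined. A
spanning cell of one remainder that crosses the hyperplane of `S` contains a short segment crossing
this hyperplane and no other split hyperplane. That remainder is affine along the segment, so all
bending there comes from its multiple of `w_S`; the other remainder can only add bending, so its
coefficient is no larger (`coeff_le_of_coherent`). Symmetry gives equality, and the other terms
follow. -/

noncomputable section

namespace PointConfig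

variable {d : ℕ} {ι : Type*}

/-! ### Affine functionals and minorants

A point `x` of `ℝ × ℝ^d` is identified with the affine functional `ev x`, so that the envelope of
`w` consists of the affine functionals that are bounded by `w` on the configuration. -/

/-- The affine functional `y ↦ -(x.1 + ⟪y, x.2⟫)`. -/
def ev (x : ℝ × EuclideanSpace ℝ (Fin d)) (y : EuclideanSpace ℝ (Fin d)) : ℝ :=
  -(x.1 + inner ℝ y x.2)

section ev

variable (x x' : ℝ × EuclideanSpace ℝ (Fin d)) (y : EuclideanSpace ℝ (Fin d))

@[simp] lemma ev_zero : ev (0 : ℝ × EuclideanSpace ℝ (Fin d)) y = 0 := by simp [ev]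

lemma ev_add : ev (x + x') y = ev x y + ev x' y := by
  simp [ev, inner_add_right]; ring

lemma ev_smul (t : ℝ) : ev (t • x) y = t * ev x y := by
  simp [ev, inner_smul_right]; ring

lemma ev_neg : ev (-x) y = -ev x y := by
  simp [ev]; ring

lemma ev_sub : ev (x - x') y = ev x y - ev x' y := by
  rw [sub_eq_add_neg, ev_add, ev_neg]; ring

lemma ev_sum {κ : Type*} (s : Finset κ) (f : κ → ℝ × EuclideanSpace ℝ (Fin d)) :
    ev (∑ k ∈ s, f k) y = ∑ k ∈ s, ev (f k) y := by
  induction s using Finset.cons_induction with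
  | empty => simp
  | cons k s hk ih => rw [Finset.sum_cons, Finset.sum_cons, ev_add, ih]

lemma ev_add_right (v : EuclideanSpace ℝ (Fin d)) :
    ev x (y + v) = ev x y - inner ℝ v x.2 := by
  simp [ev, inner_add_left]; ring

lemma ev_combo (y' : EuclideanSpace ℝ (Fin d)) {s t : ℝ} (h : s + t = 1) :
    ev x (s • y + t • y') = s * ev x y + t * ev x y' := by
  simp only [ev, inner_add_left, inner_smul_left, RCLike.conj_to_real]
  linear_combination x.1 * h

lemma continuous_ev : Continuous (ev x) := by
  unfold ev; fun_prop

lemma ev_mk (c : ℝ) (u : EuclideanSpace ℝ (Fin d)) : ev (-c, u) y = c - inner ℝ u y := by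
  simp [ev, real_inner_comm]; ring

variable {x} in
lemma ev_eq_zero_iff : (∀ y, ev x y = 0) ↔ x = 0 := by
  refine ⟨fun h => ?_, fun h => by simp [h]⟩
  have h1 : x.1 = 0 := by simpa [ev] using h 0
  have h2 : x.2 = 0 := by
    have := h x.2
    simpa [ev, h1] using this
  exact Prod.ext h1 h2

end ev

lemma convex_ev_le (x : ℝ × EuclideanSpace ℝ (Fin d)) (c : ℝ) : Convex ℝ {y | ev x y ≤ c} := by
  intro y hy y' hy' s t hs ht hst
  simp only [Set.mem_ofPred_eq] at *
  rw [ev_combo _ _ _ hst]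
  calc s * ev x y + t * ev x y' ≤ s * c + t * c := by gcongr
    _ = c := by rw [← add_mul, hst, one_mul]

lemma ev_le_of_mem_hull {a : ι → EuclideanSpace ℝ (Fin d)} {F : Set ι}
    {x x' : ℝ × EuclideanSpace ℝ (Fin d)} (h : ∀ i ∈ F, ev x (a i) ≤ ev x' (a i))
    {y : EuclideanSpace ℝ (Fin d)} (hy : y ∈ hull a F) : ev x y ≤ ev x' y := by
  have : hull a F ⊆ {y | ev (x - x') y ≤ 0} := by
    refine convexHull_min ?_ (convex_ev_le _ _)
    rintro _ ⟨i, hi, rfl⟩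
    simpa [ev_sub] using h i hi
  simpa [ev_sub] using this hy

lemma ev_nonpos_of_mem_hull {a : ι → EuclideanSpace ℝ (Fin d)} {F : Set ι}
    {x : ℝ × EuclideanSpace ℝ (Fin d)} (h : ∀ i ∈ F, ev x (a i) ≤ 0)
    {y : EuclideanSpace ℝ (Fin d)} (hy : y ∈ hull a F) : ev x y ≤ 0 := by
  simpa using ev_le_of_mem_hull (x' := 0) (by simpa using h) hy

lemma ev_nonneg_of_mem_hull {a : ι → EuclideanSpace ℝ (Fin d)} {F : Set ι}
    {x : ℝ × EuclideanSpace ℝ (Fin d)} (h : ∀ i ∈ F, 0 ≤ ev x (a i))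
    {y : EuclideanSpace ℝ (Fin d)} (hy : y ∈ hull a F) : 0 ≤ ev x y := by
  simpa using ev_le_of_mem_hull (x := 0) (by simpa using h) hy

lemma ev_eq_zero_of_mem_hull {a : ι → EuclideanSpace ℝ (Fin d)} {F : Set ι}
    {x : ℝ × EuclideanSpace ℝ (Fin d)} (h : ∀ i ∈ F, ev x (a i) = 0)
    {y : EuclideanSpace ℝ (Fin d)} (hy : y ∈ hull a F) : ev x y = 0 :=
  le_antisymm (ev_nonpos_of_mem_hull (fun i hi => (h i hi).le) hy)
    (ev_nonneg_of_mem_hull (fun i hi => (h i hi).ge) hy)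

lemma mem_hull {a : ι → EuclideanSpace ℝ (Fin d)} {F : Set ι} {i : ι} (hi : i ∈ F) :
    a i ∈ hull a F := subset_convexHull ℝ _ ⟨i, hi, rfl⟩

lemma hull_mono (a : ι → EuclideanSpace ℝ (Fin d)) {F G : Set ι} (h : F ⊆ G) :
    hull a F ⊆ hull a G := convexHull_mono (Set.image_mono h)

lemma convex_hull (a : ι → EuclideanSpace ℝ (Fin d)) (F : Set ι) : Convex ℝ (hull a F) :=
  convex_convexHull ℝ _

lemma isClosed_hull [Finite ι] (a : ι → EuclideanSpace ℝ (Fin d)) (F : Set ι) :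
    IsClosed (hull a F) :=
  ((Set.toFinite (a '' F)).isCompact_convexHull (𝕜 := ℝ)).isClosed

lemma hull_nonempty {a : ι → EuclideanSpace ℝ (Fin d)} {F : Set ι} :
    (hull a F).Nonempty ↔ F.Nonempty := by
  simp [hull]

/-- The labels on which an affine functional attains the weight. -/
def tight (a : ι → EuclideanSpace ℝ (Fin d)) (w : ι → ℝ) (x : ℝ × EuclideanSpace ℝ (Fin d)) :
    Set ι := {i | ev x (a i) = w i}

lemma mem_envelope {a : ι → EuclideanSpace ℝ (Fin d)} {w : ι → ℝ}
    {x : ℝ × EuclideanSpace ℝ (Fin d)} : x ∈ envelope a w ↔ ∀ i, ev x (a i) ≤ w i :=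
  forall_congr' fun i => by rw [ev, neg_le]

lemma add_mem_envelope {a : ι → EuclideanSpace ℝ (Fin d)} {w w' : ι → ℝ}
    {x x' : ℝ × EuclideanSpace ℝ (Fin d)} (hx : x ∈ envelope a w) (hx' : x' ∈ envelope a w') :
    x + x' ∈ envelope a (w + w') := by
  rw [mem_envelope] at *
  intro i
  rw [ev_add]
  exact add_le_add (hx i) (hx' i)

lemma sum_mem_envelope {κ : Type*} {a : ι → EuclideanSpace ℝ (Fin d)} {s : Finset κ}
    {w : κ → ι → ℝ} {x : κ → ℝ × EuclideanSpace ℝ (Fin d)} (hx : ∀ k, x k ∈ envelope a (w k)) :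
    ∑ k ∈ s, x k ∈ envelope a (∑ k ∈ s, w k) := by
  rw [mem_envelope]
  intro i
  rw [ev_sum, Finset.sum_apply]
  exact Finset.sum_le_sum fun k _ => mem_envelope.1 (hx k) i

lemma convex_envelope (a : ι → EuclideanSpace ℝ (Fin d)) (w : ι → ℝ) :
    Convex ℝ (envelope a w) := by
  intro x hx x' hx' s t hs ht hst
  rw [mem_envelope] at *
  intro i
  rw [ev_add, ev_smul, ev_smul]
  calc s * ev x (a i) + t * ev x' (a i) ≤ s * w i + t * w i := by
        gcongr
        exacts [hx i, hx' i]
    _ = w i := by rw [← add_mul, hst, one_mul]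

lemma envelope_nonempty [Finite ι] (a : ι → EuclideanSpace ℝ (Fin d)) (w : ι → ℝ) :
    (envelope a w).Nonempty := by
  obtain ⟨M, hM⟩ := (Set.finite_range fun i => -w i).bddAbove
  refine ⟨(M, 0), fun i => ?_⟩
  simpa using hM ⟨i, rfl⟩

lemma envelope_add_zero (a : ι → EuclideanSpace ℝ (Fin d)) (w : ι → ℝ) :
    envelope a w + envelope a 0 = envelope a w := by
  refine Set.Subset.antisymm ?_ fun x hx => ⟨x, hx, 0, ?_, add_zero x⟩
  · rintro _ ⟨x, hx, z, hz, rfl⟩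
    simpa using add_mem_envelope hx hz
  · simp [mem_envelope]

/-- The points with labels in `T` affinely span the space, expressed dually. -/
def Spans (a : ι → EuclideanSpace ℝ (Fin d)) (T : Set ι) : Prop :=
  ∀ x, (∀ i ∈ T, ev x (a i) = 0) → x = 0

lemma spans_univ {a : ι → EuclideanSpace ℝ (Fin d)} (ha : affineSpan ℝ (Set.range a) = ⊤) :
    Spans a Set.univ := by
  intro x hx
  refine ev_eq_zero_iff.1 fun y => ?_
  have hy : y ∈ affineSpan ℝ (Set.range a) := ha ▸ AffineSubspace.mem_top ℝ _ y
  refine affineSpan_induction hy ?_ fun c u v w hu hv hw => ?_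
  · rintro _ ⟨i, rfl⟩
    exact hx i trivial
  · rw [vsub_eq_sub, vadd_eq_add, add_comm, ev_add_right, inner_smul_left, inner_sub_left]
    simp only [ev] at hu hv hw
    rw [ev]
    simp only [RCLike.conj_to_real]
    linear_combination hw + c * hu - c * hv

/-- A vector orthogonal to the vector span yields an affine functional vanishing on `T`. -/
lemma Spans.affineSpan_eq_top {a : ι → EuclideanSpace ℝ (Fin d)} {T : Set ι} (h : Spans a T) :
    affineSpan ℝ (a '' T) = ⊤ := by
  rcases T.eq_empty_or_nonempty with rfl | ⟨i₀, hi₀⟩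
  -- With no labels, even a nonzero constant functional would have to vanish.
  · simpa using h (1, 0) (by simp)
  rw [AffineSubspace.affineSpan_eq_top_iff_vectorSpan_eq_top_of_nonempty ℝ _ _
    (s := a '' T) ⟨_, i₀, hi₀, rfl⟩]
  rw [← Submodule.orthogonal_eq_bot_iff, Submodule.eq_bot_iff]
  intro v hv
  have := h (-inner ℝ (a i₀) v, v) fun i hi => by
    have h1 : a i -ᵥ a i₀ ∈ vectorSpan ℝ (a '' T) :=
      vsub_mem_vectorSpan ℝ ⟨i, hi, rfl⟩ ⟨i₀, hi₀, rfl⟩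
    have h2 := (Submodule.mem_orthogonal _ _).1 hv _ h1
    rw [vsub_eq_sub, inner_sub_left] at h2
    simp only [ev]
    linarith
  exact congrArg Prod.snd this

lemma Spans.interior_nonempty {a : ι → EuclideanSpace ℝ (Fin d)} {T : Set ι} (h : Spans a T) :
    (interior (hull a T)).Nonempty :=
  interior_convexHull_nonempty_iff_affineSpan_eq_top.2 h.affineSpan_eq_top

/-- The vertices of the envelope: the minorants that are tight on a spanning set. -/
def vertices (a : ι → EuclideanSpace ℝ (Fin d)) (w : ι → ℝ) :
    Set (ℝ × EuclideanSpace ℝ (Fin d)) :=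
  {x ∈ envelope a w | Spans a (tight a w x)}

/-- A vertex is determined by its tight set: two minorants tight on the same spanning set agree. -/
lemma finite_vertices [Finite ι] (a : ι → EuclideanSpace ℝ (Fin d)) (w : ι → ℝ) :
    (vertices a w).Finite := by
  refine Set.Finite.of_finite_image (f := tight a w) (Set.toFinite _) ?_
  intro x hx x' _ h
  refine sub_eq_zero.1 (hx.2 _ fun i hi => ?_)
  have hi' : i ∈ tight a w x' := by rw [← h]; exact hi
  rw [ev_sub, sub_eq_zero]
  exact Eq.trans hi (Eq.symm hi')

/-- Moving a minorant in a direction that vanishes on the tight labels and is somewhere positive,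
until a further label becomes tight. -/
lemma exists_tight_ssubset [Finite ι] {a : ι → EuclideanSpace ℝ (Fin d)} {w : ι → ℝ}
    {x m : ℝ × EuclideanSpace ℝ (Fin d)} (hx : x ∈ envelope a w)
    (hm : ∀ i ∈ tight a w x, ev m (a i) = 0) (hpos : ∃ i, 0 < ev m (a i)) :
    ∃ t > (0 : ℝ), x + t • m ∈ envelope a w ∧ tight a w x ⊂ tight a w (x + t • m) := by
  rw [mem_envelope] at hx
  -- Ratio test: the least ratio of slack to growth is the step at which a new label becomes tight.
  obtain ⟨j, hj, hmin⟩ := Set.exists_min_image {i | 0 < ev m (a i)}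
    (fun i => (w i - ev x (a i)) / ev m (a i)) (Set.toFinite _) hpos
  have hj : 0 < ev m (a j) := hj
  have hjx : ev x (a j) < w j := lt_of_le_of_ne (hx j) fun h => hj.ne' (hm j h)
  refine ⟨(w j - ev x (a j)) / ev m (a j), div_pos (sub_pos.2 hjx) hj, ?_, ?_⟩
  · rw [mem_envelope]
    intro i
    rw [ev_add, ev_smul]
    rcases lt_or_ge 0 (ev m (a i)) with hi | hi
    · have := (le_div_iff₀ hi).1 (hmin i hi)
      linarith
    · have := mul_nonpos_of_nonneg_of_nonpos (div_pos (sub_pos.2 hjx) hj).le hi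
      have := hx i
      linarith
  · refine (Set.ssubset_iff_of_subset fun i hi => ?_).2 ⟨j, ?_, hjx.ne⟩
    · have hi' : ev x (a i) = w i := hi
      simp [tight, ev_add, ev_smul, hm i hi, hi']
    · simp only [tight, Set.mem_ofPred_eq, ev_add, ev_smul]
      field_simp
      ring

/-- The envelope is generated by its vertices and the envelope of zero, its recession cone. -/
lemma envelope_subset_of_convex [Finite ι] {a : ι → EuclideanSpace ℝ (Fin d)}
    (ha : Spans a Set.univ) {w : ι → ℝ} {K : Set (ℝ × EuclideanSpace ℝ (Fin d))}
    (hK : Convex ℝ K) (hV : vertices a w ⊆ K) (h0 : ∀ x ∈ K, ∀ z ∈ envelope a 0, x + z ∈ K) :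
    envelope a w ⊆ K := by
  intro x hx
  -- Induction on the number of labels that are not tight.
  induction hn : (tight a w x)ᶜ.ncard using Nat.strong_induction_on generalizing x with
  | _ n ih =>
  subst hn
  by_cases hs : Spans a (tight a w x)
  · exact hV ⟨hx, hs⟩
  simp only [Spans, not_forall] at hs
  obtain ⟨m, hm, hm0⟩ := hs
  have key : ∀ m, (∀ i ∈ tight a w x, ev m (a i) = 0) → (∃ i, 0 < ev m (a i)) →
      ∃ t > (0 : ℝ), x + t • m ∈ K := by
    intro m hm hp
    obtain ⟨t, ht, h1, h2⟩ := exists_tight_ssubset hx hm hp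
    refine ⟨t, ht, ih _ (Set.ncard_lt_ncard ?_ (Set.toFinite _)) h1 rfl⟩
    exact compl_lt_compl_iff_lt.2 h2
  have hm' : ∀ i ∈ tight a w x, ev (-m) (a i) = 0 := fun i hi => by rw [ev_neg, hm i hi, neg_zero]
  by_cases hp : ∃ i, 0 < ev m (a i)
  · obtain ⟨t, ht, h1⟩ := key m hm hp
    by_cases hq : ∃ i, 0 < ev (-m) (a i)
    · obtain ⟨s, hs, h2⟩ := key (-m) hm' hq
      -- With these weights `x` is the convex combination of `x + t • m` and `x - s • m`.
      have := hK h1 h2 (a := s / (s + t)) (b := t / (s + t)) (by positivity) (by positivity)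
        (by field_simp)
      convert this using 1
      have hst : s + t ≠ 0 := by positivity
      rw [smul_add, smul_add, add_add_add_comm, ← add_smul, smul_smul, smul_smul, smul_neg,
        ← sub_eq_add_neg, ← sub_smul, ← add_div, div_self hst, one_smul]
      have : s / (s + t) * t - t / (s + t) * s = 0 := by ring
      rw [this, zero_smul, add_zero]
    -- Here `-m` is a recession direction, leading from `x + t • m` back to `x`.
    · have := h0 _ h1 (t • -m) (mem_envelope.2 fun i => by
        rw [ev_smul]
        exact mul_nonpos_of_nonneg_of_nonpos ht.le (not_lt.1 (not_exists.1 hq i)))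
      simpa using this
  · have hle : ∀ i, ev m (a i) ≤ 0 := fun i => not_lt.1 (not_exists.1 hp i)
    have hq : ∃ i, 0 < ev (-m) (a i) := by
      by_contra hq
      refine hm0 (ha m fun i _ => le_antisymm (hle i) ?_)
      have := not_lt.1 (not_exists.1 hq i)
      rw [ev_neg] at this
      linarith
    obtain ⟨s, hs, h2⟩ := key (-m) hm' hq
    have := h0 _ h2 (s • m) (mem_envelope.2 fun i => by
        rw [ev_smul]
        exact mul_nonpos_of_nonneg_of_nonpos hs.le (hle i))
    simpa using this

lemma exists_vertex [Finite ι] {a : ι → EuclideanSpace ℝ (Fin d)}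
    (ha : Spans a Set.univ) {w : ι → ℝ} {x : ℝ × EuclideanSpace ℝ (Fin d)}
    (hx : x ∈ envelope a w) : ∃ y ∈ vertices a w, tight a w x ⊆ tight a w y := by
  induction hn : (tight a w x)ᶜ.ncard using Nat.strong_induction_on generalizing x with
  | _ n ih =>
  subst hn
  by_cases hs : Spans a (tight a w x)
  · exact ⟨x, ⟨hx, hs⟩, subset_rfl⟩
  simp only [Spans, not_forall] at hs
  obtain ⟨m, hm, hm0⟩ := hs
  obtain ⟨m, hm, hp⟩ : ∃ m, (∀ i ∈ tight a w x, ev m (a i) = 0) ∧ ∃ i, 0 < ev m (a i) := by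
    by_cases hp : ∃ i, 0 < ev m (a i)
    · exact ⟨m, hm, hp⟩
    · refine ⟨-m, fun i hi => by rw [ev_neg, hm i hi, neg_zero], ?_⟩
      by_contra hq
      refine hm0 (ha m fun i _ => le_antisymm (not_lt.1 (not_exists.1 hp i)) ?_)
      have := not_lt.1 (not_exists.1 hq i)
      rw [ev_neg] at this
      linarith
  obtain ⟨t, ht, h1, h2⟩ := exists_tight_ssubset hx hm hp
  obtain ⟨y, hy, hy'⟩ := ih _ (Set.ncard_lt_ncard (compl_lt_compl_iff_lt.2 h2)
    (Set.toFinite _)) h1 rfl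
  exact ⟨y, hy, h2.subset.trans hy'⟩

/-! ### Relative interiors -/

lemma mem_intrinsicInterior_iff_ball {C : Set (EuclideanSpace ℝ (Fin d))}
    {z : EuclideanSpace ℝ (Fin d)} :
    z ∈ intrinsicInterior ℝ C ↔ z ∈ affineSpan ℝ C ∧
      ∃ ε > 0, ∀ y ∈ affineSpan ℝ C, dist y z < ε → y ∈ C := by
  rw [mem_intrinsicInterior]
  constructor
  · rintro ⟨z, hz, rfl⟩
    refine ⟨z.2, ?_⟩
    obtain ⟨ε, hε, h⟩ := Metric.mem_nhds_iff.1 (mem_interior_iff_mem_nhds.1 hz)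
    exact ⟨ε, hε, fun y hy hd => h (show (⟨y, hy⟩ : affineSpan ℝ C) ∈ Metric.ball z ε from hd)⟩
  · rintro ⟨hz, ε, hε, h⟩
    refine ⟨⟨z, hz⟩, mem_interior_iff_mem_nhds.2 (Metric.mem_nhds_iff.2 ⟨ε, hε, ?_⟩), rfl⟩
    exact fun y hy => h y y.2 hy

lemma exists_add_smul_sub_mem {C : Set (EuclideanSpace ℝ (Fin d))}
    {z y : EuclideanSpace ℝ (Fin d)} (hz : z ∈ intrinsicInterior ℝ C) (hy : y ∈ C) :
    ∃ ε > (0 : ℝ), z + ε • (z - y) ∈ C := by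
  obtain ⟨hz, ε, hε, h⟩ := mem_intrinsicInterior_iff_ball.1 hz
  -- The `+ 1` keeps the denominator positive when `z = y`.
  have hpos : 0 < ‖z - y‖ + 1 := by positivity
  refine ⟨ε / (‖z - y‖ + 1), by positivity, h _ ?_ ?_⟩
  · rw [add_comm]
    exact AffineSubspace.smul_vsub_vadd_mem _ _ hz (subset_affineSpan ℝ _ hy) hz
  · rw [dist_eq_norm, add_sub_cancel_left, norm_smul, Real.norm_of_nonneg (by positivity),
      div_mul_eq_mul_div, div_lt_iff₀ hpos]
    nlinarith

/-- A functional that attains its maximum at a relative interior point is constant. -/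
lemma ev_eq_zero_of_relint {a : ι → EuclideanSpace ℝ (Fin d)} {F : Set ι}
    {x : ℝ × EuclideanSpace ℝ (Fin d)} (hx : ∀ i ∈ F, ev x (a i) ≤ 0)
    {z : EuclideanSpace ℝ (Fin d)} (hz : z ∈ intrinsicInterior ℝ (hull a F)) (hxz : ev x z = 0)
    {i : ι} (hi : i ∈ F) : ev x (a i) = 0 := by
  obtain ⟨ε, hε, h⟩ := exists_add_smul_sub_mem hz (mem_hull hi)
  have h1 := ev_nonpos_of_mem_hull hx h
  rw [ev_add_right, inner_smul_left, inner_sub_left, hxz] at h1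
  simp only [RCLike.conj_to_real] at h1
  have h2 := hx i hi
  have h3 : inner ℝ z x.2 - inner ℝ (a i) x.2 = ev x (a i) := by
    simp only [ev] at *; linarith
  rw [h3] at h1
  nlinarith

lemma relint_nonempty {a : ι → EuclideanSpace ℝ (Fin d)} {F : Set ι} (hF : F.Nonempty) :
    (intrinsicInterior ℝ (hull a F)).Nonempty :=
  (intrinsicInterior_nonempty (convex_hull a F)).2 (hull_nonempty.2 hF)

/-- A point of a polytope outside the relative interior lies on a proper supporting hyperplane. -/
lemma exists_supporting {a : ι → EuclideanSpace ℝ (Fin d)} {F : Set ι}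
    {z : EuclideanSpace ℝ (Fin d)} (hz : z ∈ hull a F)
    (hz' : z ∉ intrinsicInterior ℝ (hull a F)) :
    ∃ x, (∀ i ∈ F, ev x (a i) ≤ 0) ∧ ev x z = 0 ∧ ∃ i ∈ F, ev x (a i) < 0 := by
  set C := hull a F with hC
  have hzA : z ∈ affineSpan ℝ C := subset_affineSpan ℝ _ hz
  set V := (affineSpan ℝ C).direction with hV
  -- Translation into the direction space turns the relative interior into an interior, so that
  -- Hahn–Banach applies to lower-dimensional polytopes too.
  let D : Set V := {v | z + (v : EuclideanSpace ℝ (Fin d)) ∈ C}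
  have hDc : Convex ℝ D := by
    intro v hv v' hv' s t hs ht hst
    have := convex_hull a F hv hv' hs ht hst
    have e : z + ((s • v + t • v' : V) : EuclideanSpace ℝ (Fin d))
        = s • (z + (v : EuclideanSpace ℝ (Fin d))) + t • (z + (v' : EuclideanSpace ℝ (Fin d))) := by
      rw [smul_add, smul_add, add_add_add_comm, ← add_smul, hst, one_smul]
      simp
    change z + ((s • v + t • v' : V) : EuclideanSpace ℝ (Fin d)) ∈ C
    rw [e]
    exact this
  have hmemA : ∀ v : V, z + (v : EuclideanSpace ℝ (Fin d)) ∈ affineSpan ℝ C := fun v => by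
    rw [add_comm]
    exact AffineSubspace.vadd_mem_of_mem_direction v.2 hzA
  have hint : ∀ v : V, v ∈ interior D ↔
      z + (v : EuclideanSpace ℝ (Fin d)) ∈ intrinsicInterior ℝ C := by
    intro v
    rw [mem_intrinsicInterior_iff_ball, mem_interior_iff_mem_nhds, Metric.mem_nhds_iff]
    constructor
    · rintro ⟨ε, hε, h⟩
      refine ⟨hmemA v, ε, hε, fun y hy hd => ?_⟩
      have hyV : y - z ∈ V := AffineSubspace.vsub_mem_direction hy hzA
      have : (⟨y - z, hyV⟩ : V) ∈ D := h (by
        rw [Metric.mem_ball, Subtype.dist_eq, dist_eq_norm]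
        rw [dist_eq_norm] at hd
        rwa [sub_sub])
      simpa [D] using this
    · rintro ⟨-, ε, hε, h⟩
      refine ⟨ε, hε, fun v' hv' => h _ (hmemA v') ?_⟩
      rw [Metric.mem_ball, Subtype.dist_eq] at hv'
      rwa [dist_add_left]
  have h0 : (0 : V) ∉ interior D := by
    rw [hint]; simpa using hz'
  obtain ⟨f, hf⟩ := geometric_hahn_banach_open_point hDc.interior isOpen_interior h0
  rw [map_zero] at hf
  obtain ⟨z₁, hz₁⟩ := relint_nonempty (a := a) (F := F) (hull_nonempty.1 ⟨z, hz⟩)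
  have hz₁V : z₁ - z ∈ V :=
    AffineSubspace.vsub_mem_direction (mem_intrinsicInterior_iff_ball.1 hz₁).1 hzA
  have hne : (⟨z₁ - z, hz₁V⟩ : V) ∈ interior D := by
    rw [hint]; simpa using hz₁
  have hfD : ∀ v ∈ D, f v ≤ 0 := by
    intro v hv
    have hv' : v ∈ closure (interior D) := by
      rw [hDc.closure_interior_eq_closure_of_nonempty_interior ⟨_, hne⟩]
      exact subset_closure hv
    exact closure_minimal (fun u hu => (hf u hu).le) (isClosed_le f.continuous continuous_const) hv'
  let n : V := (InnerProductSpace.toDual ℝ V).symm f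
  have hn : ∀ v : V, inner ℝ (n : EuclideanSpace ℝ (Fin d)) v = f v := fun v => by
    rw [← Submodule.coe_inner]
    exact InnerProductSpace.toDual_symm_apply
  have hev : ∀ y, ev (inner ℝ (n : EuclideanSpace ℝ (Fin d)) z, -(n : EuclideanSpace ℝ (Fin d))) y
      = inner ℝ (n : EuclideanSpace ℝ (Fin d)) (y - z) := fun y => by
    rw [ev, inner_neg_right, inner_sub_right, real_inner_comm y]; ring
  have hFV : ∀ y ∈ C, y - z ∈ V := fun y hy =>
    AffineSubspace.vsub_mem_direction (subset_affineSpan ℝ _ hy) hzA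
  have hle : ∀ y ∈ C, ev (inner ℝ (n : EuclideanSpace ℝ (Fin d)) z,
      -(n : EuclideanSpace ℝ (Fin d))) y ≤ 0 := fun y hy => by
    rw [hev, hn ⟨y - z, hFV y hy⟩]
    exact hfD _ (by simpa [D] using hy)
  refine ⟨(inner ℝ (n : EuclideanSpace ℝ (Fin d)) z, -(n : EuclideanSpace ℝ (Fin d))),
    fun i hi => hle _ (mem_hull hi), by rw [hev]; simp, ?_⟩
  -- The separation is strict at the relative interior point `z₁`, so the functional is not
  -- nonnegative on all of `F`.
  by_contra! hcon
  have h1 := ev_nonneg_of_mem_hull hcon (intrinsicInterior_subset hz₁)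
  rw [hev, hn ⟨z₁ - z, hz₁V⟩] at h1
  exact absurd (hf _ hne) (not_lt.2 h1)

/-! ### Faces -/

lemma isFace_iff {a : ι → EuclideanSpace ℝ (Fin d)} {F G : Set ι} :
    IsFace a F G ↔ F.Nonempty ∧ ∃ x, (∀ i ∈ G, ev x (a i) ≤ 0) ∧ F = {i ∈ G | ev x (a i) = 0} := by
  refine and_congr_right fun _ => ⟨?_, ?_⟩
  · rintro ⟨u, c, h, rfl⟩
    refine ⟨(-c, u), fun i hi => ?_, ?_⟩
    · rw [ev_mk]; linarith [h i hi]
    · simp only [ev_mk, sub_eq_zero, eq_comm (a := c)]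
  · rintro ⟨x, h, rfl⟩
    refine ⟨x.2, -x.1, fun i hi => ?_, ?_⟩
    · have := h i hi
      rw [ev, real_inner_comm] at this
      linarith
    · ext i
      simp only [Set.mem_ofPred_eq, ev, real_inner_comm]
      refine and_congr_right fun _ => ?_
      constructor <;> intro h <;> linarith

lemma IsFace.subset {a : ι → EuclideanSpace ℝ (Fin d)} {F G : Set ι} (h : IsFace a F G) :
    F ⊆ G := by
  obtain ⟨-, x, -, rfl⟩ := isFace_iff.1 h
  exact fun i hi => hi.1

lemma IsFace.refl (a : ι → EuclideanSpace ℝ (Fin d)) {G : Set ι} (h : G.Nonempty) :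
    IsFace a G G :=
  isFace_iff.2 ⟨h, 0, by simp, by simp⟩

/-- A large multiple of the functional exposing `G` is added to the one exposing `F`: the sum is
negative on the rest of `H` and unchanged on `G`. -/
lemma IsFace.trans [Finite ι] {a : ι → EuclideanSpace ℝ (Fin d)} {F G H : Set ι}
    (hFG : IsFace a F G) (hGH : IsFace a G H) : IsFace a F H := by
  obtain ⟨hne, x, hx, rfl⟩ := isFace_iff.1 hFG
  obtain ⟨-, y, hy, rfl⟩ := isFace_iff.1 hGH
  obtain ⟨N, hN⟩ := (Set.finite_range fun i => (ev x (a i) + 1) / -ev y (a i)).bddAbove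
  set M := max N 0
  have hlt : ∀ i ∈ H, ev y (a i) ≠ 0 → ev (M • y + x) (a i) < 0 := by
    intro i hi h0
    have hneg : 0 < -ev y (a i) := neg_pos.2 (lt_of_le_of_ne (hy i hi) h0)
    have h1 : (ev x (a i) + 1) / -ev y (a i) ≤ M := (hN ⟨i, rfl⟩).trans (le_max_left _ _)
    rw [div_le_iff₀ hneg] at h1
    rw [ev_add, ev_smul]
    linarith
  have heq : ∀ i, ev y (a i) = 0 → ev (M • y + x) (a i) = ev x (a i) := by
    intro i h0
    rw [ev_add, ev_smul, h0, mul_zero, zero_add]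
  refine isFace_iff.2 ⟨hne, M • y + x, fun i hi => ?_, ?_⟩
  · by_cases h0 : ev y (a i) = 0
    · rw [heq i h0]; exact hx i ⟨hi, h0⟩
    · exact (hlt i hi h0).le
  · ext i
    simp only [Set.mem_ofPred_eq]
    constructor
    · rintro ⟨⟨hi, h0⟩, h1⟩
      exact ⟨hi, (heq i h0).trans h1⟩
    · rintro ⟨hi, h1⟩
      by_cases h0 : ev y (a i) = 0
      · exact ⟨⟨hi, h0⟩, (heq i h0) ▸ h1⟩
      · exact absurd h1 (hlt i hi h0).ne

lemma IsFace.of_subset {a : ι → EuclideanSpace ℝ (Fin d)} {F G H : Set ι}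
    (hF : IsFace a F H) (hFG : F ⊆ G) (hGH : G ⊆ H) : IsFace a F G := by
  obtain ⟨hne, x, hx, rfl⟩ := isFace_iff.1 hF
  refine isFace_iff.2 ⟨hne, x, fun i hi => hx i (hGH hi), ?_⟩
  ext i
  exact ⟨fun hi => ⟨hFG hi, hi.2⟩, fun hi => ⟨hGH hi.1, hi.2⟩⟩

/-- The property proved for the whole hull is convex, because a combination of nonpositive numbers
with positive weights vanishes only if both do. -/
lemma mem_hull_of_ev_eq_zero {a : ι → EuclideanSpace ℝ (Fin d)} {G : Set ι}
    {x : ℝ × EuclideanSpace ℝ (Fin d)} (hx : ∀ i ∈ G, ev x (a i) ≤ 0)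
    {z : EuclideanSpace ℝ (Fin d)} (hz : z ∈ hull a G) (hxz : ev x z = 0) :
    z ∈ hull a {i ∈ G | ev x (a i) = 0} := by
  suffices h : hull a G ⊆ {y | ev x y ≤ 0 ∧ (ev x y = 0 → y ∈ hull a {i ∈ G | ev x (a i) = 0})} from
    (h hz).2 hxz
  refine convexHull_min ?_ ?_
  · rintro _ ⟨i, hi, rfl⟩
    exact ⟨hx i hi, fun h => mem_hull ⟨hi, h⟩⟩
  · intro y hy y' hy' s t hs ht hst
    refine ⟨convex_ev_le x 0 hy.1 hy'.1 hs ht hst, fun h => ?_⟩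
    rw [ev_combo _ _ _ hst] at h
    rcases hs.eq_or_lt with rfl | hs'
    · obtain rfl : t = 1 := by linarith
      simp only [zero_mul, one_mul, zero_add] at h
      simpa using hy'.2 h
    rcases ht.eq_or_lt with rfl | ht'
    · obtain rfl : s = 1 := by linarith
      simp only [zero_mul, one_mul, add_zero] at h
      simpa using hy.2 h
    · have h1 := hy.1
      have h2 := hy'.1
      have h3 : ev x y = 0 := by nlinarith
      have h4 : ev x y' = 0 := by nlinarith
      exact convex_hull _ _ (hy.2 h3) (hy'.2 h4) hs ht hst

/-- Every point of a polytope lies in the relative interior of a face. -/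
lemma exists_face_relint [Finite ι] {a : ι → EuclideanSpace ℝ (Fin d)} {G : Set ι}
    {z : EuclideanSpace ℝ (Fin d)} (hz : z ∈ hull a G) :
    ∃ F, IsFace a F G ∧ z ∈ intrinsicInterior ℝ (hull a F) := by
  induction hn : G.ncard using Nat.strong_induction_on generalizing G with
  | _ n ih =>
  subst hn
  by_cases hr : z ∈ intrinsicInterior ℝ (hull a G)
  · exact ⟨G, IsFace.refl a (hull_nonempty.1 ⟨z, hz⟩), hr⟩
  obtain ⟨x, hx, hxz, i, hi, hxi⟩ := exists_supporting hz hr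
  have hz' := mem_hull_of_ev_eq_zero hx hz hxz
  have hface : IsFace a {i ∈ G | ev x (a i) = 0} G :=
    isFace_iff.2 ⟨hull_nonempty.1 ⟨z, hz'⟩, x, hx, rfl⟩
  obtain ⟨F, hF, hzF⟩ := ih _ (Set.ncard_lt_ncard ((Set.ssubset_iff_of_subset hface.subset).2
    ⟨i, hi, fun h => hxi.ne h.2⟩) (Set.toFinite _)) hz' rfl
  exact ⟨F, hF.trans hface, hzF⟩

lemma IsFace.subset_of_mem_relint {a : ι → EuclideanSpace ℝ (Fin d)} {F F' G : Set ι}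
    (hF : IsFace a F G) (hF' : F' ⊆ G) {z : EuclideanSpace ℝ (Fin d)}
    (hz : z ∈ hull a F) (hz' : z ∈ intrinsicInterior ℝ (hull a F')) : F' ⊆ F := by
  obtain ⟨-, x, hx, rfl⟩ := isFace_iff.1 hF
  exact fun i hi => ⟨hF' hi, ev_eq_zero_of_relint (fun j hj => hx j (hF' hj)) hz'
    (ev_eq_zero_of_mem_hull (fun j hj => hj.2) hz) hi⟩

lemma IsFace.eq_of_mem_relint {a : ι → EuclideanSpace ℝ (Fin d)} {F F' G : Set ι}
    (hF : IsFace a F G) (hF' : IsFace a F' G) {z : EuclideanSpace ℝ (Fin d)}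
    (hz : z ∈ intrinsicInterior ℝ (hull a F)) (hz' : z ∈ intrinsicInterior ℝ (hull a F')) :
    F = F' :=
  Set.Subset.antisymm (hF'.subset_of_mem_relint hF.subset (intrinsicInterior_subset hz') hz)
    (hF.subset_of_mem_relint hF'.subset (intrinsicInterior_subset hz) hz')

/-! ### Subdivisions -/

lemma IsSubdivision.eq_of_mem_relint {a : ι → EuclideanSpace ℝ (Fin d)} {S : Set (Set ι)}
    (hS : IsSubdivision a S) {F F' : Set ι} (hF : F ∈ S) (hF' : F' ∈ S)
    {z : EuclideanSpace ℝ (Fin d)} (hz : z ∈ intrinsicInterior ℝ (hull a F))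
    (hz' : z ∈ intrinsicInterior ℝ (hull a F')) : F = F' := by
  by_contra h
  have := hS.disjoint F hF F' hF' h
  exact (Set.ext_iff.1 this z).1 ⟨hz, hz'⟩

/-- A cell of a subdivision with a relative interior point in another cell is a face of it. -/
lemma IsSubdivision.isFace_of_mem [Finite ι] {a : ι → EuclideanSpace ℝ (Fin d)} {S : Set (Set ι)}
    (hS : IsSubdivision a S) {F G : Set ι} (hF : F ∈ S) (hG : G ∈ S)
    {z : EuclideanSpace ℝ (Fin d)} (hz : z ∈ intrinsicInterior ℝ (hull a F))
    (hz' : z ∈ hull a G) : IsFace a F G := by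
  obtain ⟨F', hF', h⟩ := exists_face_relint hz'
  rwa [hS.eq_of_mem_relint hF (hS.face_mem G hG F' hF') hz h]

lemma IsSubdivision.isFace_of_hull_subset [Finite ι] {a : ι → EuclideanSpace ℝ (Fin d)}
    {S : Set (Set ι)} (hS : IsSubdivision a S) {F G : Set ι} (hF : F ∈ S) (hG : G ∈ S)
    (h : hull a F ⊆ hull a G) : IsFace a F G := by
  obtain ⟨z, hz⟩ := relint_nonempty (a := a) (hS.nonempty F hF)
  exact hS.isFace_of_mem hF hG hz (h (intrinsicInterior_subset hz))

/-- A subdivision with a cell that covers everything consists of the faces of that cell. -/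
lemma IsSubdivision.eq_faces [Finite ι] {a : ι → EuclideanSpace ℝ (Fin d)} {S : Set (Set ι)}
    (hS : IsSubdivision a S) {G : Set ι} (hG : G ∈ S) (h : hull a Set.univ ⊆ hull a G) :
    S = {F | IsFace a F G} :=
  Set.Subset.antisymm
    (fun _ hF => hS.isFace_of_hull_subset hF hG ((hull_mono a (Set.subset_univ _)).trans h))
    fun _ hF => hS.face_mem G hG _ hF

lemma isSubdivision_faces [Finite ι] {a : ι → EuclideanSpace ℝ (Fin d)} {G : Set ι}
    (h : hull a Set.univ ⊆ hull a G) : IsSubdivision a {F | IsFace a F G} where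
  nonempty _ hF := hF.1
  face_mem _ hF _ hF' := hF'.trans hF
  cover := by
    refine Set.Subset.antisymm (fun z hz => ?_)
      (Set.iUnion₂_subset fun F _ => hull_mono a (Set.subset_univ F))
    obtain ⟨F, hF, hzF⟩ := exists_face_relint (h hz)
    exact Set.mem_iUnion₂.2 ⟨F, hF, intrinsicInterior_subset hzF⟩
  disjoint F hF F' hF' hne := by
    refine Set.eq_empty_of_forall_notMem fun z hz => hne ?_
    exact hF.eq_of_mem_relint hF' hz.1 hz.2

lemma exists_maximalFace [Finite ι] {S : Set (Set ι)} {F : Set ι} (hF : F ∈ S) :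
    ∃ G ∈ maximalFaces S, F ⊆ G := by
  obtain ⟨G, hFG, hG⟩ := (Set.toFinite S).exists_le_maximal hF
  exact ⟨G, hG, hFG⟩

/-! ### Splits with one maximal face -/

/-- If the cells contained every label, the unique maximal face would be the whole configuration and
the subdivision trivial. -/
lemma exists_notMem_of_isKSplit_one [Finite ι] {a : ι → EuclideanSpace ℝ (Fin d)}
    {S : Set (Set ι)} (hS : IsKSplit a 1 S) : ∃ p, ∀ G ∈ S, p ∉ G := by
  obtain ⟨⟨hsub, hne, -⟩, hcard, -⟩ := hS
  obtain ⟨M, hM⟩ := Set.ncard_eq_one.1 hcard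
  have hle : ∀ G ∈ S, G ⊆ M := fun G hG => by
    obtain ⟨M', hM', h⟩ := exists_maximalFace hG
    rw [hM] at hM'
    exact h.trans hM'.le
  have hMS : M ∈ S := by
    have : M ∈ maximalFaces S := by rw [hM]; rfl
    exact this.1
  by_contra! hcon
  refine hne (hsub.eq_faces (G := Set.univ) ?_ subset_rfl)
  convert hMS
  refine (Set.eq_univ_of_forall fun p => ?_).symm
  obtain ⟨G, hG, hp⟩ := hcon p
  exact hle G hG hp

lemma IsSubdivision.mem_hull_compl {a : ι → EuclideanSpace ℝ (Fin d)} {p : ι}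
    (hS : IsSubdivision a (pointSplit a p)) : a p ∈ hull a {p}ᶜ := by
  have h : a p ∈ hull a Set.univ := mem_hull trivial
  rw [hS.cover] at h
  obtain ⟨F, hF, h⟩ := Set.mem_iUnion₂.1 h
  exact hull_mono a hF.subset h

/-- Deleting `p` does not change the hull. A coarsening has a cell containing `{p}ᶜ`; it is `{p}ᶜ`
or everything, covers the hull, and so determines the subdivision. -/
lemma isKSplit_pointSplit [Finite ι] {a : ι → EuclideanSpace ℝ (Fin d)}
    (ha : Spans a Set.univ) {p : ι} (hp : a p ∈ hull a {p}ᶜ) :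
    IsKSplit a 1 (pointSplit a p) := by
  have hcov : hull a Set.univ ⊆ hull a {p}ᶜ := by
    refine convexHull_min ?_ (convex_hull _ _)
    rintro _ ⟨i, -, rfl⟩
    by_cases h : i = p
    · rwa [h]
    · exact mem_hull h
  have hne : ({p}ᶜ : Set ι).Nonempty := hull_nonempty.1 ⟨_, hp⟩
  have hmem : {p}ᶜ ∈ pointSplit a p := IsFace.refl a hne
  have hsub : IsSubdivision a (pointSplit a p) := isSubdivision_faces hcov
  have hheq : hull a {p}ᶜ = hull a Set.univ := (hull_mono a (Set.subset_univ _)).antisymm hcov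
  have hmax : maximalFaces (pointSplit a p) = {{p}ᶜ} := by
    ext F
    constructor
    · intro hF
      exact hF.eq_of_le hmem (IsFace.subset hF.1)
    · rintro rfl
      exact ⟨hmem, fun F hF _ => IsFace.subset hF⟩
  refine ⟨⟨hsub, fun h => ?_, fun T hT hr => ?_⟩, by rw [hmax]; simp, {p}ᶜ, hmem, fun h => ?_, ?_⟩
  · have : Set.univ ∈ pointSplit a p := by
      rw [h]
      exact IsFace.refl a ⟨p, trivial⟩
    exact IsFace.subset this (Set.mem_univ p) rfl
  · obtain ⟨G, hG, hle⟩ := hr _ hmem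
    by_cases hpG : p ∈ G
    · right
      have : G = Set.univ := Set.eq_univ_of_forall fun i => by
        by_cases h : i = p
        · rwa [h]
        · exact hle h
      exact hT.eq_faces (this ▸ hG) subset_rfl
    · left
      have : G = {p}ᶜ := Set.Subset.antisymm (fun i hi h => hpG (h ▸ hi)) hle
      exact hT.eq_faces (this ▸ hG) hcov
  · obtain ⟨z, hz⟩ := ha.interior_nonempty
    rw [hheq] at h
    exact (h (interior_subset hz)).2 hz
  · have h1 : affineSpan ℝ (a '' {p}ᶜ) = ⊤ := by
      rw [← affineSpan_convexHull]
      change affineSpan ℝ (hull a {p}ᶜ) = ⊤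
      rw [hheq, hull, affineSpan_convexHull, ha.affineSpan_eq_top]
    rw [← direction_affineSpan, h1, AffineSubspace.direction_top, finrank_top]
    simp

/-! ### Splits with two maximal faces -/

/-- `h` is a normalized affine functional whose zero set is the hyperplane of the split `S`. -/
structure IsSplitFunctional (a : ι → EuclideanSpace ℝ (Fin d)) (S : Set (Set ι))
    (h : ℝ × EuclideanSpace ℝ (Fin d)) : Prop where
  norm_eq : ‖h.2‖ = 1
  faces : S = {F | IsFace a F {i | 0 ≤ ev h (a i)} ∨ IsFace a F {i | ev h (a i) ≤ 0}}
  hyperplane : ∀ y, y ∈ splitHyperplane a S ↔ ev h y = 0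
  exists_pos : ∃ i, 0 < ev h (a i)
  exists_neg : ∃ i, ev h (a i) < 0
  cover : ∀ y ∈ hull a Set.univ,
    y ∈ hull a {i | 0 ≤ ev h (a i)} ∨ y ∈ hull a {i | ev h (a i) ≤ 0}
  maximalFaces_eq : maximalFaces S = {{i | 0 ≤ ev h (a i)}, {i | ev h (a i) ≤ 0}}

lemma IsSplitFunctional.neg {a : ι → EuclideanSpace ℝ (Fin d)} {S : Set (Set ι)}
    {h : ℝ × EuclideanSpace ℝ (Fin d)} (H : IsSplitFunctional a S h) :
    IsSplitFunctional a S (-h) where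
  norm_eq := by simpa using H.norm_eq
  faces := by
    simp only [ev_neg, Left.nonneg_neg_iff, Left.neg_nonpos_iff]
    rw [H.faces]
    ext F
    exact or_comm
  hyperplane y := by rw [H.hyperplane, ev_neg, neg_eq_zero]
  exists_pos := by simpa only [ev_neg, Left.neg_pos_iff] using H.exists_neg
  exists_neg := by simpa only [ev_neg, Left.neg_neg_iff] using H.exists_pos
  cover y hy := by
    simp only [ev_neg, Left.nonneg_neg_iff, Left.neg_nonpos_iff]
    exact (H.cover y hy).symm
  maximalFaces_eq := by
    simp only [ev_neg, Left.nonneg_neg_iff, Left.neg_nonpos_iff]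
    rw [H.maximalFaces_eq, Set.pair_comm]

/-- An affine functional vanishing on a hyperplane is a multiple of the one defining it. -/
lemma exists_eq_smul_of_forall {h x : ℝ × EuclideanSpace ℝ (Fin d)} (hh : h.2 ≠ 0)
    {y₀ : EuclideanSpace ℝ (Fin d)} (hy₀ : ev h y₀ = 0) (hx : ∀ y, ev h y = 0 → ev x y = 0) :
    ∃ c : ℝ, x = c • h := by
  have hn : inner ℝ h.2 h.2 ≠ (0 : ℝ) := inner_self_ne_zero.2 hh
  -- The projection coefficient: the linear part of the remainder `m` is orthogonal to `h.2`, so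
  -- moving from `y₀` by `m.2` stays on the hyperplane and forces `m.2 = 0`.
  set c : ℝ := inner ℝ x.2 h.2 / inner ℝ h.2 h.2
  refine ⟨c, sub_eq_zero.1 ?_⟩
  set m := x - c • h with hm
  have hm0 : ∀ y, ev h y = 0 → ev m y = 0 := fun y hy => by
    rw [ev_sub, ev_smul, hy, hx y hy]; simp
  have horth : inner ℝ m.2 h.2 = (0 : ℝ) := by
    simp only [hm, Prod.snd_sub, Prod.smul_snd, inner_sub_left, inner_smul_left,
      RCLike.conj_to_real, c]
    field_simp
    ring
  have h1 := hm0 (y₀ + m.2) (by rw [ev_add_right, hy₀, horth, sub_zero])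
  rw [ev_add_right, hm0 y₀ hy₀, zero_sub, neg_eq_zero, inner_self_eq_zero] at h1
  have h2 := hm0 y₀ hy₀
  rw [ev, h1, inner_zero_right, add_zero, neg_eq_zero] at h2
  exact Prod.ext h2 h1

/-- The vector span lies in the orthogonal complement of `h.2`, and both have dimension `d - 1`. -/
lemma mem_affineSpan_iff_ev_eq_zero {a : ι → EuclideanSpace ℝ (Fin d)} {F : Set ι}
    {h : ℝ × EuclideanSpace ℝ (Fin d)} (hF : F.Nonempty) (hh : h.2 ≠ 0)
    (h0 : ∀ i ∈ F, ev h (a i) = 0) (hfr : Module.finrank ℝ (vectorSpan ℝ (a '' F)) + 1 = d)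
    (y : EuclideanSpace ℝ (Fin d)) : y ∈ affineSpan ℝ (a '' F) ↔ ev h y = 0 := by
  obtain ⟨i₀, hi₀⟩ := hF
  have hmem : a i₀ ∈ affineSpan ℝ (a '' F) := subset_affineSpan ℝ _ ⟨i₀, hi₀, rfl⟩
  have hle : vectorSpan ℝ (a '' F) ≤ (Submodule.span ℝ {h.2})ᗮ := by
    rw [vectorSpan_def, Submodule.span_le]
    rintro _ ⟨_, ⟨i, hi, rfl⟩, _, ⟨j, hj, rfl⟩, rfl⟩
    rw [SetLike.mem_coe, Submodule.mem_orthogonal_singleton_iff_inner_left]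
    have h1 := h0 i hi
    have h2 := h0 j hj
    simp only [ev] at h1 h2
    simp only [vsub_eq_sub, inner_sub_left]
    linarith
  have heq : vectorSpan ℝ (a '' F) = (Submodule.span ℝ {h.2})ᗮ := by
    refine Submodule.eq_of_le_of_finrank_eq hle ?_
    have h1 := Submodule.finrank_add_finrank_orthogonal (Submodule.span ℝ {h.2})
    rw [finrank_span_singleton hh, finrank_euclideanSpace_fin] at h1
    omega
  have h1 : y ∈ affineSpan ℝ (a '' F) ↔ y - a i₀ ∈ vectorSpan ℝ (a '' F) := by
    rw [← direction_affineSpan, ← vsub_eq_sub, AffineSubspace.vsub_right_mem_direction_iff_mem hmem]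
  rw [h1, heq, Submodule.mem_orthogonal_singleton_iff_inner_left, inner_sub_left]
  have h2 := h0 i₀ hi₀
  simp only [ev] at h2 ⊢
  constructor <;> intro h <;> linarith

lemma exists_ev_eq_zero_of_finrank {a : ι → EuclideanSpace ℝ (Fin d)} {F : Set ι}
    (hF : F.Nonempty) (hfr : Module.finrank ℝ (vectorSpan ℝ (a '' F)) + 1 = d) :
    ∃ h : ℝ × EuclideanSpace ℝ (Fin d), h.2 ≠ 0 ∧ ∀ i ∈ F, ev h (a i) = 0 := by
  obtain ⟨i₀, hi₀⟩ := hF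
  have hne : (vectorSpan ℝ (a '' F))ᗮ ≠ ⊥ := by
    intro h
    rw [Submodule.orthogonal_eq_bot_iff] at h
    rw [h, finrank_top, finrank_euclideanSpace_fin] at hfr
    omega
  obtain ⟨u, hu, hu0⟩ := Submodule.exists_mem_ne_zero_of_ne_bot hne
  refine ⟨(-inner ℝ (a i₀) u, u), hu0, fun i hi => ?_⟩
  have h1 := (Submodule.mem_orthogonal _ _).1 hu _
    (vsub_mem_vectorSpan ℝ ⟨i, hi, rfl⟩ ⟨i₀, hi₀, rfl⟩ : a i -ᵥ a i₀ ∈ vectorSpan ℝ (a '' F))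
  rw [vsub_eq_sub, inner_sub_left] at h1
  simp only [ev]
  linarith

lemma mem_interior_of_relint {a : ι → EuclideanSpace ℝ (Fin d)} (ha : Spans a Set.univ)
    {z : EuclideanSpace ℝ (Fin d)} (hz : z ∈ intrinsicInterior ℝ (hull a Set.univ)) :
    z ∈ interior (hull a Set.univ) := by
  obtain ⟨-, ε, hε, h⟩ := mem_intrinsicInterior_iff_ball.1 hz
  refine mem_interior_iff_mem_nhds.2 (Metric.mem_nhds_iff.2 ⟨ε, hε, fun y hy => h y ?_ hy⟩)
  rw [hull, affineSpan_convexHull, ha.affineSpan_eq_top]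
  exact AffineSubspace.mem_top ℝ _ y

/-- The relative interior of an interior face lies in the interior. -/
lemma IsInterior.relint_subset [Finite ι] {a : ι → EuclideanSpace ℝ (Fin d)}
    (ha : Spans a Set.univ) {F : Set ι} (hF : IsInterior a F) {z : EuclideanSpace ℝ (Fin d)}
    (hz : z ∈ intrinsicInterior ℝ (hull a F)) : z ∈ interior (hull a Set.univ) := by
  refine mem_interior_of_relint ha ?_
  by_contra hcon
  obtain ⟨x, hx, hxz, i, -, hi⟩ := exists_supporting
    (hull_mono a (Set.subset_univ F) (intrinsicInterior_subset hz)) hcon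
  obtain ⟨y, hy, hyf⟩ := Set.not_subset.1 hF
  have hyi : y ∈ interior (hull a Set.univ) := by
    by_contra h
    exact hyf ⟨subset_closure (hull_mono a (Set.subset_univ F) hy), h⟩
  -- The supporting functional vanishes on `F`, hence at the interior point `y`, and so at every
  -- label.
  refine hi.ne (ev_eq_zero_of_relint hx (interior_subset_intrinsicInterior hyi) ?_ trivial)
  exact ev_eq_zero_of_mem_hull
    (fun j hj => ev_eq_zero_of_relint (fun i _ => hx i trivial) hz hxz hj) hy

/-- The points `z + t • h.2` with small `t > 0` are strictly on the negative side, which `hull a P`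
misses, so they lie in `hull a Q`; then `t` tends to `0`. -/
lemma mem_hull_of_interior [Finite ι] {a : ι → EuclideanSpace ℝ (Fin d)} {P Q : Set ι}
    (hcov : ∀ y ∈ hull a Set.univ, y ∈ hull a P ∨ y ∈ hull a Q)
    {h : ℝ × EuclideanSpace ℝ (Fin d)} (hh : h.2 ≠ 0) (hP : ∀ i ∈ P, 0 ≤ ev h (a i))
    {z : EuclideanSpace ℝ (Fin d)} (hz : z ∈ interior (hull a Set.univ)) (hhz : ev h z = 0) :
    z ∈ hull a Q ∧ ∃ q ∈ Q, ev h (a q) < 0 := by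
  have hlim : Filter.Tendsto (fun t : ℝ => z + t • h.2) (nhdsWithin 0 (Set.Ioi 0)) (nhds z) := by
    have : Continuous fun t : ℝ => z + t • h.2 := by fun_prop
    simpa using (this.tendsto 0).mono_left nhdsWithin_le_nhds
  have hneg : ∀ t > (0 : ℝ), ev h (z + t • h.2) < 0 := fun t ht => by
    rw [ev_add_right, hhz, inner_smul_left, zero_sub, neg_lt_zero]
    exact mul_pos ht (real_inner_self_pos.2 hh)
  have hev : ∀ᶠ t in nhdsWithin (0 : ℝ) (Set.Ioi 0), z + t • h.2 ∈ hull a Q := by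
    filter_upwards [hlim.eventually (mem_interior_iff_mem_nhds.1 hz), self_mem_nhdsWithin]
      with t ht ht0
    refine (hcov _ ht).resolve_left fun hp => ?_
    exact absurd (ev_nonneg_of_mem_hull hP hp) (not_le.2 (hneg t ht0))
  refine ⟨(isClosed_hull a Q).mem_of_tendsto hlim hev, ?_⟩
  obtain ⟨t, ht, ht0⟩ := (hev.and self_mem_nhdsWithin).exists
  by_contra! hcon
  exact absurd (ev_nonneg_of_mem_hull hcon ht) (not_le.2 (hneg t ht0))

/-- The two sides of a hyperplane that meets the configuration suitably form a subdivision. -/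
lemma isSubdivision_sides [Finite ι] {a : ι → EuclideanSpace ℝ (Fin d)}
    {h : ℝ × EuclideanSpace ℝ (Fin d)}
    (hcov : ∀ y ∈ hull a Set.univ,
      y ∈ hull a {i | 0 ≤ ev h (a i)} ∨ y ∈ hull a {i | ev h (a i) ≤ 0}) :
    IsSubdivision a
      {F | IsFace a F {i | 0 ≤ ev h (a i)} ∨ IsFace a F {i | ev h (a i) ≤ 0}} where
  nonempty F hF := hF.elim (·.1) (·.1)
  face_mem F hF F' hF' := hF.imp hF'.trans hF'.trans
  cover := by
    refine Set.Subset.antisymm (fun z hz => ?_)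
      (Set.iUnion₂_subset fun F _ => hull_mono a (Set.subset_univ F))
    rcases hcov z hz with hz | hz <;> obtain ⟨F, hF, hzF⟩ := exists_face_relint hz
    · exact Set.mem_iUnion₂.2 ⟨F, Or.inl hF, intrinsicInterior_subset hzF⟩
    · exact Set.mem_iUnion₂.2 ⟨F, Or.inr hF, intrinsicInterior_subset hzF⟩
  disjoint F hF F' hF' hne := by
    refine Set.eq_empty_of_forall_notMem fun z hz => hne ?_
    -- A relative interior point shared by cells on opposite sides lies on the hyperplane, so both
    -- cells are faces of the set of labels on it.
    have key : ∀ {F F' : Set ι}, IsFace a F {i | 0 ≤ ev h (a i)} →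
        IsFace a F' {i | ev h (a i) ≤ 0} → z ∈ intrinsicInterior ℝ (hull a F) →
        z ∈ intrinsicInterior ℝ (hull a F') → F = F' := by
      intro F F' hF hF' hz hz'
      have h1 : 0 ≤ ev h z :=
        ev_nonneg_of_mem_hull (fun i hi => hF.subset hi) (intrinsicInterior_subset hz)
      have h2 : ev h z ≤ 0 :=
        ev_nonpos_of_mem_hull (fun i hi => hF'.subset hi) (intrinsicInterior_subset hz')
      have h0 := le_antisymm h2 h1
      have hFz : F ⊆ {i | ev h (a i) = 0} := fun i hi => by
        have := ev_eq_zero_of_relint (x := -h) (fun j hj => by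
          rw [ev_neg]; exact neg_nonpos.2 (hF.subset hj)) hz (by rw [ev_neg, h0, neg_zero]) hi
        rwa [ev_neg, neg_eq_zero] at this
      have hFz' : F' ⊆ {i | ev h (a i) = 0} := fun i hi =>
        ev_eq_zero_of_relint (fun j hj => hF'.subset hj) hz' h0 hi
      exact (hF.of_subset hFz fun i hi => Eq.ge hi).eq_of_mem_relint
        (hF'.of_subset hFz' fun i hi => Eq.le hi) hz hz'
    rcases hF with hF | hF <;> rcases hF' with hF' | hF'
    · exact hF.eq_of_mem_relint hF' hz.1 hz.2
    · exact key hF hF' hz.1 hz.2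
    · exact (key hF' hF hz.2 hz.1).symm
    · exact hF.eq_of_mem_relint hF' hz.1 hz.2

/-- The cell `F` is a proper face of both maximal cells and spans a hyperplane, so the functionals
exposing it in `P` and `Q` define that hyperplane, with `P` and `Q` on opposite sides. The two
closed sides form a nontrivial subdivision refined by `S`, which is `S` by coarseness. -/
lemma IsCoarsest.exists_isSplitFunctional [Finite ι] {a : ι → EuclideanSpace ℝ (Fin d)}
    (ha : Spans a Set.univ) {S : Set (Set ι)} (hS : IsCoarsest a S) {P Q F : Set ι} (hPQ : P ≠ Q)
    (hmax : maximalFaces S = {P, Q}) (hF : F ∈ S) (hFi : IsInterior a F)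
    (hfr : Module.finrank ℝ (vectorSpan ℝ (a '' F)) + 1 = d) (hFP : F ⊆ P) :
    ∃ h, IsSplitFunctional a S h := by
  obtain ⟨hsub, -, hcoarse⟩ := hS
  have hPm : Maximal (· ∈ S) P := by
    have : P ∈ maximalFaces S := by simp [hmax]
    exact this
  have hQm : Maximal (· ∈ S) Q := by
    have : Q ∈ maximalFaces S := by simp [hmax]
    exact this
  have hle : ∀ G ∈ S, G ⊆ P ∨ G ⊆ Q := fun G hG => by
    obtain ⟨M, hM, hGM⟩ := exists_maximalFace hG
    rw [hmax] at hM
    rcases hM with rfl | rfl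
    exacts [Or.inl hGM, Or.inr hGM]
  have hcov : ∀ y ∈ hull a Set.univ, y ∈ hull a P ∨ y ∈ hull a Q := fun y hy => by
    rw [hsub.cover] at hy
    obtain ⟨G, hG, hy⟩ := Set.mem_iUnion₂.1 hy
    exact (hle G hG).imp (fun h => hull_mono a h hy) fun h => hull_mono a h hy
  have hFne := hsub.nonempty F hF
  obtain ⟨z, hz⟩ := relint_nonempty (a := a) hFne
  have hzi := hFi.relint_subset ha hz
  have hzF := intrinsicInterior_subset hz
  have hFP' : IsFace a F P := hsub.isFace_of_mem hF hPm.1 hz (hull_mono a hFP hzF)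
  -- Otherwise `P` is flat and `Q` covers the points near `z` off the hyperplane; then `z` lies in
  -- `hull a Q` and `P` is a face of `Q`, against maximality.
  have hFnP : F ≠ P := by
    rintro rfl
    obtain ⟨h, hh, h0⟩ := exists_ev_eq_zero_of_finrank hFne hfr
    have h1 := (mem_hull_of_interior hcov hh (fun i hi => (h0 i hi).ge) hzi
      (ev_eq_zero_of_mem_hull h0 hzF)).1
    exact hPQ (hPm.eq_of_le hQm.1 (hsub.isFace_of_mem hF hQm.1 hz h1).subset)
  obtain ⟨-, x, hx, hFx⟩ := isFace_iff.1 hFP'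
  obtain ⟨p, hp, hpF⟩ := Set.exists_of_ssubset (hFP.ssubset_of_ne hFnP)
  have hxp : ev x (a p) < 0 := lt_of_le_of_ne (hx p hp) fun h => hpF (hFx ▸ ⟨hp, h⟩)
  obtain ⟨f, hf⟩ := hFne
  have hxF : ∀ i ∈ F, ev x (a i) = 0 := fun i hi => by rw [hFx] at hi; exact hi.2
  have hx2 : x.2 ≠ 0 := fun h0 => by
    have h1 := hxF f hf
    simp only [ev, h0, inner_zero_right] at h1 hxp
    linarith
  have hnx : 0 < ‖x.2‖ := norm_pos_iff.2 hx2
  set h : ℝ × EuclideanSpace ℝ (Fin d) := (-‖x.2‖⁻¹) • x with hhdef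
  have hev : ∀ y, ev h y = -(‖x.2‖⁻¹ * ev x y) := fun y => by rw [hhdef, ev_smul]; ring
  have hnorm : ‖h.2‖ = 1 := by
    rw [hhdef, Prod.smul_snd, norm_smul, norm_neg, norm_inv, norm_norm, inv_mul_cancel₀ hnx.ne']
  have hh : h.2 ≠ 0 := fun h0 => by simp [h0] at hnorm
  have hP : ∀ i ∈ P, 0 ≤ ev h (a i) := fun i hi => by
    rw [hev, neg_nonneg]
    exact mul_nonpos_of_nonneg_of_nonpos (inv_nonneg.2 hnx.le) (hx i hi)
  have hp0 : 0 < ev h (a p) := by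
    rw [hev, neg_pos]
    exact mul_neg_of_pos_of_neg (inv_pos.2 hnx) hxp
  have hF0 : ∀ i ∈ F, ev h (a i) = 0 := fun i hi => by rw [hev, hxF i hi]; simp
  have hspan := mem_affineSpan_iff_ev_eq_zero ⟨f, hf⟩ hh hF0 hfr
  obtain ⟨hzQ, q, hq, hq0⟩ := mem_hull_of_interior hcov hh hP hzi (ev_eq_zero_of_mem_hull hF0 hzF)
  have hFQ := hsub.isFace_of_mem hF hQm.1 hz hzQ
  obtain ⟨-, x', hx', hFx'⟩ := isFace_iff.1 hFQ
  have hx'F : ∀ i ∈ F, ev x' (a i) = 0 := fun i hi => by rw [hFx'] at hi; exact hi.2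
  have hx'q : ev x' (a q) < 0 := lt_of_le_of_ne (hx' q hq) fun h0 => by
    have : q ∈ F := by rw [hFx']; exact ⟨hq, h0⟩
    exact hq0.ne (hF0 q this)
  have hx'2 : x'.2 ≠ 0 := fun h0 => by
    have h1 := hx'F f hf
    simp only [ev, h0, inner_zero_right] at h1 hx'q
    linarith
  have hspan' := mem_affineSpan_iff_ev_eq_zero ⟨f, hf⟩ hx'2 hx'F hfr
  obtain ⟨c, rfl⟩ := exists_eq_smul_of_forall hh (hF0 f hf)
    (fun y hy => (hspan' y).1 ((hspan y).2 hy))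
  have hc : 0 < c := by
    rw [ev_smul] at hx'q
    by_contra hcon
    have := mul_nonneg_of_nonpos_of_nonpos (not_lt.1 hcon) hq0.le
    linarith
  have hQ : ∀ i ∈ Q, ev h (a i) ≤ 0 := fun i hi => by
    have := hx' i hi
    rw [ev_smul] at this
    exact nonpos_of_mul_nonpos_right this hc
  have hcov' : ∀ y ∈ hull a Set.univ,
      y ∈ hull a {i | 0 ≤ ev h (a i)} ∨ y ∈ hull a {i | ev h (a i) ≤ 0} := fun y hy =>
    (hcov y hy).imp (fun H => hull_mono a hP H) fun H => hull_mono a hQ H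
  have hT := isSubdivision_sides hcov'
  have hPne : {i | 0 ≤ ev h (a i)}.Nonempty := ⟨p, hp0.le⟩
  have hQne : {i | ev h (a i) ≤ 0}.Nonempty := ⟨q, hq0.le⟩
  have hTS : S = {F | IsFace a F {i | 0 ≤ ev h (a i)} ∨ IsFace a F {i | ev h (a i) ≤ 0}} := by
    refine ((hcoarse _ hT fun G hG => ?_).resolve_right fun h0 => ?_).symm
    · rcases hle G hG with hG | hG
      · exact ⟨_, Or.inl (IsFace.refl a hPne), hG.trans hP⟩
      · exact ⟨_, Or.inr (IsFace.refl a hQne), hG.trans hQ⟩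
    -- `p` and `q` keep the full label set from being a cell of the two-sided subdivision.
    · have h1 : Set.univ ∈ trivialSubdivision a := IsFace.refl a ⟨p, trivial⟩
      rw [← h0] at h1
      rcases h1 with h1 | h1
      · exact absurd (h1.subset (Set.mem_univ q)) (not_le.2 hq0)
      · exact absurd (h1.subset (Set.mem_univ p)) (not_le.2 hp0)
  have hPeq : P = {i | 0 ≤ ev h (a i)} :=
    hPm.eq_of_le (by rw [hTS]; exact Or.inl (IsFace.refl a hPne)) hP
  have hQeq : Q = {i | ev h (a i) ≤ 0} :=
    hQm.eq_of_le (by rw [hTS]; exact Or.inr (IsFace.refl a hQne)) hQ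
  refine ⟨h, hnorm, hTS, fun y => ?_, ⟨p, hp0⟩, ⟨q, hq0⟩, hcov', by rw [hmax, hPeq, hQeq]⟩
  have hFeq : F = P ∩ Q := by
    refine Set.Subset.antisymm (Set.subset_inter hFP hFQ.subset) fun i hi => ?_
    rw [hFx]
    refine ⟨hi.1, ?_⟩
    have h1 := le_antisymm (hQ i hi.2) (hP i hi.1)
    rw [hev, neg_eq_zero] at h1
    exact (mul_eq_zero.1 h1).resolve_left (inv_pos.2 hnx).ne'
  rw [splitHyperplane, hmax, Set.sInter_pair, ← hFeq, hspan]

lemma IsKSplit.exists_isSplitFunctional [Finite ι] {a : ι → EuclideanSpace ℝ (Fin d)}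
    (ha : Spans a Set.univ) {S : Set (Set ι)} (hS : IsKSplit a 2 S) :
    ∃ h, IsSplitFunctional a S h := by
  obtain ⟨hc, hcard, F, hF, hFi, hfr⟩ := hS
  obtain ⟨P, Q, hPQ, hmax⟩ := Set.ncard_eq_two.1 hcard
  obtain ⟨M, hM, hFM⟩ := exists_maximalFace hF
  rw [hmax] at hM
  rcases hM with rfl | rfl
  · exact hc.exists_isSplitFunctional ha hPQ hmax hF hFi (by omega) hFM
  · exact hc.exists_isSplitFunctional ha hPQ.symm (by rw [hmax, Set.pair_comm]) hF hFi
      (by omega) hFM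

/-- The split functional that is nonnegative on a given maximal face. -/
lemma IsKSplit.exists_isSplitFunctional_side [Finite ι] {a : ι → EuclideanSpace ℝ (Fin d)}
    (ha : Spans a Set.univ) {S : Set (Set ι)} (hS : IsKSplit a 2 S) {P : Set ι}
    (hP : P ∈ maximalFaces S) :
    ∃ h, IsSplitFunctional a S h ∧ P = {i | 0 ≤ ev h (a i)} := by
  obtain ⟨h, H⟩ := hS.exists_isSplitFunctional ha
  rw [H.maximalFaces_eq] at hP
  rcases hP with rfl | rfl
  · exact ⟨h, H, rfl⟩
  · exact ⟨-h, H.neg, by simp only [ev_neg, Left.nonneg_neg_iff]⟩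

/-- Since `h.2` is a unit normal, `y + ev h y • h.2` is the foot of the perpendicular;
Cauchy–Schwarz gives the lower bound. -/
lemma IsSplitFunctional.infDist_eq {a : ι → EuclideanSpace ℝ (Fin d)} {S : Set (Set ι)}
    {h : ℝ × EuclideanSpace ℝ (Fin d)} (H : IsSplitFunctional a S h)
    (y : EuclideanSpace ℝ (Fin d)) : Metric.infDist y (splitHyperplane a S) = |ev h y| := by
  have hself : inner ℝ h.2 h.2 = (1 : ℝ) := by
    rw [real_inner_self_eq_norm_sq, H.norm_eq, one_pow]
  have hmem : y + ev h y • h.2 ∈ splitHyperplane a S := by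
    rw [H.hyperplane, ev_add_right, inner_smul_left, hself]
    simp
  refine le_antisymm ?_ ?_
  · refine (Metric.infDist_le_dist_of_mem hmem).trans_eq ?_
    rw [dist_eq_norm, sub_add_cancel_left, norm_neg, norm_smul, H.norm_eq, mul_one,
      Real.norm_eq_abs]
  · refine (Metric.le_infDist ⟨_, hmem⟩).2 fun y' hy' => ?_
    rw [SetLike.mem_coe, H.hyperplane] at hy'
    have h1 : ev h y = -inner ℝ (y - y') h.2 := by
      have := ev_add_right h y' (y - y')
      rw [add_sub_cancel, hy', zero_sub] at this
      exact this
    rw [h1, abs_neg, dist_eq_norm]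
    simpa [H.norm_eq] using abs_real_inner_le_norm (y - y') h.2

lemma IsSplitFunctional.splitWeight_eq {a : ι → EuclideanSpace ℝ (Fin d)} {S : Set (Set ι)}
    {h : ℝ × EuclideanSpace ℝ (Fin d)} (H : IsSplitFunctional a S h) :
    splitWeight a S {i | 0 ≤ ev h (a i)} = fun i => max (ev h (a i)) 0 := by
  ext i
  rw [splitWeight, Set.indicator_apply]
  split_ifs with hi
  · rw [H.infDist_eq, abs_of_nonneg hi, max_eq_left hi]
  · exact (max_eq_right (not_le.1 hi).le).symm

/-- Proportional functionals have the same pair of closed sides. Hence distinct splits have distinct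
hyperplanes, as uniqueness requires. -/
lemma IsSplitFunctional.eq_of_smul {a : ι → EuclideanSpace ℝ (Fin d)} {S S' : Set (Set ι)}
    {h h' : ℝ × EuclideanSpace ℝ (Fin d)} (H : IsSplitFunctional a S h)
    (H' : IsSplitFunctional a S' h') {c : ℝ} (hc : h' = c • h) : S = S' := by
  have hc0 : c ≠ 0 := by
    rintro rfl
    have := H'.norm_eq
    simp [hc] at this
  rw [H.faces, H'.faces, hc]
  rcases lt_or_gt_of_ne hc0 with hc0 | hc0
  · have h1 : ∀ r : ℝ, 0 ≤ c * r ↔ r ≤ 0 := fun r => by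
      constructor <;> intro _ <;> nlinarith
    have h2 : ∀ r : ℝ, c * r ≤ 0 ↔ 0 ≤ r := fun r => by
      constructor <;> intro _ <;> nlinarith
    simp only [ev_smul, h1, h2]
    ext F
    exact or_comm
  · have h1 : ∀ r : ℝ, 0 ≤ c * r ↔ 0 ≤ r := fun r => by
      constructor <;> intro _ <;> nlinarith
    have h2 : ∀ r : ℝ, c * r ≤ 0 ↔ r ≤ 0 := fun r => by
      constructor <;> intro _ <;> nlinarith
    simp only [ev_smul, h1, h2]

/-! ### Regular subdivisions -/

/-- A minorant `x` gives a linear functional on `ℝ × ℝ^d` with maximum `x.1` over the lifted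
polyhedron, attained among the lifted points exactly at tight labels. -/
lemma tight_mem_regularSubdivision [Finite ι] {a : ι → EuclideanSpace ℝ (Fin d)} {w : ι → ℝ}
    {x : ℝ × EuclideanSpace ℝ (Fin d)} (hx : x ∈ envelope a w) (hne : (tight a w x).Nonempty) :
    tight a w x ∈ regularSubdivision a w := by
  obtain ⟨j, hj⟩ := hne
  rw [mem_envelope] at hx
  let l : StrongDual ℝ (ℝ × EuclideanSpace ℝ (Fin d)) :=
    -(ContinuousLinearMap.fst ℝ ℝ (EuclideanSpace ℝ (Fin d))) -
      (innerSL ℝ x.2).comp (ContinuousLinearMap.snd ℝ ℝ (EuclideanSpace ℝ (Fin d)))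
  have hl : ∀ y, l y = -y.1 - inner ℝ x.2 y.2 := fun y => by simp [l]
  have hlw : ∀ i, l (w i, a i) = ev x (a i) - w i + x.1 := fun i => by
    rw [hl, ev, real_inner_comm]; ring
  have hsub : convexHull ℝ (Set.range fun i => (w i, a i)) ⊆ lift a w := fun y hy =>
    ⟨y, hy, 0, ⟨0, Set.self_mem_Ici, rfl⟩, add_zero y⟩
  have hmem : ∀ i, (w i, a i) ∈ lift a w := fun i => hsub (subset_convexHull ℝ _ ⟨i, rfl⟩)
  have hconv : ∀ y ∈ convexHull ℝ (Set.range fun i => (w i, a i)), l y ≤ x.1 := by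
    refine fun y hy => convexHull_min ?_ (convex_halfSpace_le l.isLinear x.1) hy
    rintro _ ⟨i, rfl⟩
    have := hx i
    change l (w i, a i) ≤ x.1
    rw [hlw]
    linarith
  have hlift : ∀ y ∈ lift a w, l y ≤ x.1 := by
    rintro _ ⟨q, hq, _, ⟨t, ht, rfl⟩, rfl⟩
    have ht : (0 : ℝ) ≤ t := ht
    have h1 := hconv q hq
    have h2 : l (t, (0 : EuclideanSpace ℝ (Fin d))) = -t := by simp [hl]
    change l (q + (t, 0)) ≤ x.1
    rw [map_add, h2]
    linarith
  have hlj : l (w j, a j) = x.1 := by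
    have : ev x (a j) = w j := hj
    rw [hlw, this]; ring
  refine ⟨{y ∈ lift a w | ∀ y' ∈ lift a w, l y' ≤ l y}, ⟨(w j, a j), hmem j, fun y' hy' =>
    hlj ▸ hlift y' hy'⟩, fun _ => ⟨l, rfl⟩, ?_, ?_⟩
  -- Maximality forces the vertical summand to vanish, so the face lies in a compact hull.
  · refine ((Set.finite_range fun i => (w i, a i)).isCompact_convexHull (𝕜 := ℝ)).isBounded.subset ?_
    rintro _ ⟨⟨q, hq, _, ⟨t, ht, rfl⟩, rfl⟩, hy⟩
    have ht : (0 : ℝ) ≤ t := ht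
    have h1 := hy q (hsub hq)
    have h2 : l (t, (0 : EuclideanSpace ℝ (Fin d))) = -t := by simp [hl]
    change l q ≤ l (q + (t, 0)) at h1
    rw [map_add, h2] at h1
    have h3 : t = 0 := by linarith
    subst h3
    change q + 0 ∈ _
    rwa [add_zero]
  · ext i
    constructor
    · intro hi
      have hi' : ev x (a i) = w i := hi
      refine ⟨hmem i, fun y' hy' => ?_⟩
      rw [hlw, hi']
      simpa using hlift y' hy'
    · intro hi
      have h1 := hi.2 _ (hmem j)
      rw [hlj, hlw] at h1
      exact le_antisymm (hx i) (by linarith)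

/-- A bounded face contains no upward ray, so the exposing functional has a negative vertical
coefficient `s`; dividing by `s` yields the minorant. -/
lemma exists_subset_tight_of_mem_regularSubdivision {a : ι → EuclideanSpace ℝ (Fin d)}
    {w : ι → ℝ} {F : Set ι} (hF : F ∈ regularSubdivision a w) :
    ∃ x ∈ envelope a w, F ⊆ tight a w x := by
  obtain ⟨B, ⟨y₀, hy₀⟩, hB, hbdd, rfl⟩ := hF
  obtain ⟨l, rfl⟩ := hB ⟨y₀, hy₀⟩
  have hray : ∀ t : ℝ, 0 ≤ t → y₀ + (t, 0) ∈ lift a w := by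
    intro t ht
    obtain ⟨q, hq, _, ⟨s, hs, rfl⟩, hqy⟩ := hy₀.1
    refine ⟨q, hq, _, ⟨s + t, add_nonneg hs ht, rfl⟩, ?_⟩
    rw [← hqy]
    simp [add_assoc]
  set s : ℝ := l (1, 0) with hs
  have hlt : ∀ t : ℝ, l (t, (0 : EuclideanSpace ℝ (Fin d))) = t * s := fun t => by
    rw [hs, ← smul_eq_mul, ← map_smul]
    simp
  have hs0 : s < 0 := by
    have h1 := hy₀.2 _ (hray 1 zero_le_one)
    rw [map_add, hlt] at h1
    refine lt_of_le_of_ne (by linarith) fun h0 => ?_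
    obtain ⟨R, hR⟩ := hbdd.exists_norm_le
    have h2 : ∀ t : ℝ, 0 ≤ t → |y₀.1 + t| ≤ R := fun t ht => by
      have h3 := hR (y₀ + (t, 0)) ⟨hray t ht, fun y' hy' => by
        rw [map_add, hlt, h0, mul_zero, add_zero]
        exact hy₀.2 y' hy'⟩
      exact (norm_fst_le _).trans h3
    have h3 := h2 (|y₀.1| + |R| + 1) (by positivity)
    have h4 := (le_abs_self _).trans h3
    have h5 := neg_abs_le y₀.1
    have h6 := le_abs_self R
    linarith
  let u : EuclideanSpace ℝ (Fin d) := (InnerProductSpace.toDual ℝ _).symm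
    (l.comp (ContinuousLinearMap.inr ℝ ℝ (EuclideanSpace ℝ (Fin d))))
  have hl : ∀ (t : ℝ) (y : EuclideanSpace ℝ (Fin d)), l (t, y) = t * s + inner ℝ u y := by
    intro t y
    have h1 : inner ℝ u y = l (0, y) := InnerProductSpace.toDual_symm_apply
    rw [h1, ← hlt, ← map_add]
    simp
  have hmem : ∀ i, (w i, a i) ∈ lift a w := fun i =>
    ⟨_, subset_convexHull ℝ _ ⟨i, rfl⟩, 0, ⟨0, Set.self_mem_Ici, rfl⟩, add_zero _⟩
  have hev : ∀ i, ev (-(l y₀ / s), s⁻¹ • u) (a i) = (l y₀ - inner ℝ u (a i)) / s := fun i => by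
    rw [ev, inner_smul_right, real_inner_comm]
    ring
  refine ⟨(-(l y₀ / s), s⁻¹ • u), mem_envelope.2 fun i => ?_, fun i hi => ?_⟩
  · have h1 := hy₀.2 _ (hmem i)
    rw [hl] at h1
    rw [hev, div_le_iff_of_neg hs0]
    linarith
  · have h1 := hi.2 _ hy₀.1
    have h2 := hy₀.2 _ (hmem i)
    have h3 := le_antisymm h1 h2
    rw [hl (w i)] at h3
    change ev _ (a i) = w i
    rw [hev, div_eq_iff hs0.ne]
    linarith

lemma exists_tight_not_subset_of_not_refines {a : ι → EuclideanSpace ℝ (Fin d)} {w : ι → ℝ}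
    {S : Set (Set ι)} (h : ¬ Refines (regularSubdivision a w) S) :
    ∃ x ∈ envelope a w, ∀ G ∈ S, ¬ tight a w x ⊆ G := by
  simp only [Refines, not_forall, not_exists, not_and] at h
  obtain ⟨F, hF, h⟩ := h
  obtain ⟨x, hx, hFx⟩ := exists_subset_tight_of_mem_regularSubdivision hF
  exact ⟨x, hx, fun G hG hxG => h G hG (hFx.trans hxG)⟩

/-! ### Split prime weights -/

/-- Every label is tight for some minorant: no point is lifted above the lower hull. -/
def Full (a : ι → EuclideanSpace ℝ (Fin d)) (w : ι → ℝ) : Prop :=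
  ∀ i, ∃ x ∈ envelope a w, i ∈ tight a w x

/-- Some minorant is tight on both open sides of the hyperplane of `h`. -/
def Crosses (a : ι → EuclideanSpace ℝ (Fin d)) (w : ι → ℝ)
    (h : ℝ × EuclideanSpace ℝ (Fin d)) : Prop :=
  ∃ x ∈ envelope a w, (∃ i ∈ tight a w x, 0 < ev h (a i)) ∧ ∃ i ∈ tight a w x, ev h (a i) < 0

lemma IsSplitFunctional.not_refines_iff [Finite ι] {a : ι → EuclideanSpace ℝ (Fin d)}
    {S : Set (Set ι)} {h : ℝ × EuclideanSpace ℝ (Fin d)} (H : IsSplitFunctional a S h)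
    {w : ι → ℝ} : ¬ Refines (regularSubdivision a w) S ↔ Crosses a w h := by
  constructor
  · intro hr
    obtain ⟨x, hx, hS⟩ := exists_tight_not_subset_of_not_refines hr
    rw [H.faces] at hS
    obtain ⟨i, hi⟩ := H.exists_pos
    obtain ⟨j, hj⟩ := H.exists_neg
    have h1 := hS _ (Or.inr (IsFace.refl a ⟨j, hj.le⟩))
    have h2 := hS _ (Or.inl (IsFace.refl a ⟨i, hi.le⟩))
    simp only [Set.not_subset, Set.mem_ofPred_eq, not_le] at h1 h2
    exact ⟨x, hx, h1, h2⟩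
  · rintro ⟨x, hx, ⟨i, hi, hi0⟩, j, hj, hj0⟩ hr
    obtain ⟨G, hG, hsub⟩ := hr _ (tight_mem_regularSubdivision hx ⟨i, hi⟩)
    rw [H.faces] at hG
    rcases hG with hG | hG
    · exact absurd (hG.subset (hsub hj)) (not_le.2 hj0)
    · exact absurd (hG.subset (hsub hi)) (not_le.2 hi0)

/-- At a vertex of the configuration every weight is attained. -/
lemma exists_tight_of_notMem_hull [Finite ι] {a : ι → EuclideanSpace ℝ (Fin d)} {p : ι}
    (hp : a p ∉ hull a {p}ᶜ) (w : ι → ℝ) : ∃ x ∈ envelope a w, p ∈ tight a w x := by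
  obtain ⟨f, u, hfp, hf⟩ := geometric_hahn_banach_point_closed (convex_hull a {p}ᶜ)
    (isClosed_hull a _) hp
  let n : EuclideanSpace ℝ (Fin d) := (InnerProductSpace.toDual ℝ _).symm f
  have hn : ∀ y, inner ℝ y n = f y := fun y => by
    rw [real_inner_comm]; exact InnerProductSpace.toDual_symm_apply
  -- `M` is a slope steep enough to stay below all other weights; the quotient at `i = p` is `0 / 0
  -- = 0`.
  obtain ⟨M, hM⟩ := (Set.finite_range fun i => (w p - w i) / (f (a i) - f (a p))).bddAbove
  have hev : ∀ y, ev (-w p - M * f (a p), M • n) y = w p - M * (f y - f (a p)) := fun y => by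
    rw [ev, inner_smul_right, hn]; ring
  refine ⟨(-w p - M * f (a p), M • n), mem_envelope.2 fun i => ?_, ?_⟩
  · rw [hev]
    by_cases hi : i = p
    · simp [hi]
    · have h1 : 0 < f (a i) - f (a p) := by linarith [hf _ (mem_hull (a := a) (F := {p}ᶜ) hi)]
      have h2 := (div_le_iff₀ h1).1 (hM ⟨i, rfl⟩)
      linarith
  · change ev _ _ = _
    rw [hev]; ring

/-- If `a p` lies in the hull of the other points, `S^p` is a `1`-split and not refining it makes
`p` tight somewhere; otherwise `p` is tight for some minorant of any weight. Conversely, each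
`1`-split omits a label, which a full weight uses in some cell. -/
lemma splitPrime_iff [Finite ι] {a : ι → EuclideanSpace ℝ (Fin d)} (ha : Spans a Set.univ)
    {w : ι → ℝ} : SplitPrime a w ↔
      Full a w ∧ ∀ S h, IsKSplit a 2 S → IsSplitFunctional a S h → Crosses a w h := by
  constructor
  · refine fun hw => ⟨fun p => ?_, fun S h hS H => H.not_refines_iff.1 (hw S (Or.inr hS))⟩
    by_cases hp : a p ∈ hull a {p}ᶜ
    · obtain ⟨x, hx, hS⟩ := exists_tight_not_subset_of_not_refines
        (hw _ (Or.inl (isKSplit_pointSplit ha hp)))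
      have h1 := hS _ (IsFace.refl a (hull_nonempty.1 ⟨_, hp⟩))
      obtain ⟨i, hi, hip⟩ := Set.not_subset.1 h1
      obtain rfl : i = p := by simpa using hip
      exact ⟨x, hx, hi⟩
    · exact exists_tight_of_notMem_hull hp w
  · rintro ⟨hfull, hcross⟩ S (hS | hS)
    · intro hr
      obtain ⟨p, hp⟩ := exists_notMem_of_isKSplit_one hS
      obtain ⟨x, hx, hpx⟩ := hfull p
      obtain ⟨G, hG, hsub⟩ := hr _ (tight_mem_regularSubdivision hx ⟨p, hpx⟩)
      exact hp G hG (hsub hpx)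
    · obtain ⟨h, H⟩ := hS.exists_isSplitFunctional ha
      exact H.not_refines_iff.2 (hcross S h hS H)

/-! ### Existence of the decomposition -/

/-- The positive part of an affine functional on the configuration. -/
def posWeight (a : ι → EuclideanSpace ℝ (Fin d)) (h : ℝ × EuclideanSpace ℝ (Fin d)) : ι → ℝ :=
  fun i => max (ev h (a i)) 0

/-- The weights induced by the lower hull. -/
lemma exists_full_envelope_eq [Finite ι] {a : ι → EuclideanSpace ℝ (Fin d)}
    (ha : Spans a Set.univ) (w : ι → ℝ) :
    ∃ v, Full a v ∧ envelope a v = envelope a w ∧ v ≤ w := by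
  have hne : (vertices a w).Nonempty := by
    obtain ⟨x, hx⟩ := envelope_nonempty a w
    obtain ⟨y, hy, -⟩ := exists_vertex ha hx
    exact ⟨y, hy⟩
  have hmax : ∀ i, ∃ x ∈ vertices a w, ∀ y ∈ vertices a w, ev y (a i) ≤ ev x (a i) := fun i =>
    Set.exists_max_image _ (fun y => ev y (a i)) (finite_vertices a w) hne
  choose x hx hmax using hmax
  have hle : ∀ y ∈ envelope a w, ∀ i, ev y (a i) ≤ ev (x i) (a i) := by
    intro y hy i
    -- Evaluation at `a i` does not increase along the recession cone, so the maximum over the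
    -- vertices bounds it.
    refine envelope_subset_of_convex ha (K := {y | ev y (a i) ≤ ev (x i) (a i)}) ?_
      (fun y hy => hmax i y hy) ?_ hy
    · intro y hy y' hy' s t hs ht hst
      simp only [Set.mem_ofPred_eq] at *
      rw [ev_add, ev_smul, ev_smul]
      calc s * ev y (a i) + t * ev y' (a i)
          ≤ s * ev (x i) (a i) + t * ev (x i) (a i) := by gcongr
        _ = ev (x i) (a i) := by rw [← add_mul, hst, one_mul]
    · intro y hy z hz
      have h1 := mem_envelope.1 hz i
      simp only [Set.mem_ofPred_eq, Pi.zero_apply] at *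
      rw [ev_add]
      linarith
  have hxw : ∀ i, ev (x i) (a i) ≤ w i := fun i => mem_envelope.1 (hx i).1 i
  refine ⟨fun i => ev (x i) (a i), fun i => ⟨x i, ?_, rfl⟩, ?_, hxw⟩
  · exact mem_envelope.2 (hle _ (hx i).1)
  · refine Set.Subset.antisymm (fun y hy => ?_) fun y hy => mem_envelope.2 (hle y hy)
    exact mem_envelope.2 fun i => (mem_envelope.1 hy i).trans (hxw i)

lemma Full.eq_of_envelope_eq {a : ι → EuclideanSpace ℝ (Fin d)} {v v' : ι → ℝ} (hv : Full a v)
    (hv' : Full a v') (h : envelope a v = envelope a v') : v = v' := by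
  ext i
  refine le_antisymm ?_ ?_
  · obtain ⟨x, hx, hi⟩ := hv i
    have hi : ev x (a i) = v i := hi
    rw [h] at hx
    exact hi ▸ mem_envelope.1 hx i
  · obtain ⟨x, hx, hi⟩ := hv' i
    have hi : ev x (a i) = v' i := hi
    rw [← h] at hx
    exact hi ▸ mem_envelope.1 hx i

/-- In a coherent decomposition every cell of the sum lies in a cell of a summand. -/
lemma exists_tight_subset_of_coherent {a : ι → EuclideanSpace ℝ (Fin d)} {u v : ι → ℝ}
    (h : envelope a (u + v) = envelope a u + envelope a v) {x : ℝ × EuclideanSpace ℝ (Fin d)}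
    (hx : x ∈ envelope a (u + v)) :
    ∃ y ∈ envelope a u, tight a (u + v) x ⊆ tight a u y := by
  rw [h] at hx
  obtain ⟨y, hy, z, hz, rfl⟩ := hx
  refine ⟨y, hy, fun i hi => ?_⟩
  have h1 := mem_envelope.1 hy i
  have h2 := mem_envelope.1 hz i
  have h3 : ev (y + z) (a i) = u i + v i := hi
  rw [ev_add] at h3
  exact le_antisymm h1 (by linarith)

lemma Full.of_coherent {a : ι → EuclideanSpace ℝ (Fin d)} {u v : ι → ℝ}
    (h : envelope a (u + v) = envelope a u + envelope a v) (hf : Full a (u + v)) : Full a u := by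
  intro i
  obtain ⟨x, hx, hi⟩ := hf i
  obtain ⟨y, hy, hsub⟩ := exists_tight_subset_of_coherent h hx
  exact ⟨y, hy, hsub hi⟩

lemma Crosses.of_coherent {a : ι → EuclideanSpace ℝ (Fin d)} {u v : ι → ℝ}
    {g : ℝ × EuclideanSpace ℝ (Fin d)}
    (h : envelope a (u + v) = envelope a u + envelope a v) (hc : Crosses a (u + v) g) :
    Crosses a u g := by
  obtain ⟨x, hx, ⟨i, hi, hi0⟩, j, hj, hj0⟩ := hc
  obtain ⟨y, hy, hsub⟩ := exists_tight_subset_of_coherent h hx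
  exact ⟨y, hy, ⟨i, hsub hi, hi0⟩, j, hsub hj, hj0⟩

/-- Subtracting the largest coherent multiple of a split weight. -/
lemma exists_coherent_crosses [Finite ι] {a : ι → EuclideanSpace ℝ (Fin d)}
    (ha : Spans a Set.univ) (w : ι → ℝ) {h : ℝ × EuclideanSpace ℝ (Fin d)}
    (hpos : ∃ i, 0 < ev h (a i)) (hneg : ∃ i, ev h (a i) < 0) :
    ∃ (c : ℝ) (u : ι → ℝ), 0 ≤ c ∧ w = u + c • posWeight a h ∧
      envelope a w = envelope a u + envelope a (c • posWeight a h) ∧ Crosses a u h := by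
  by_cases hcr : Crosses a w h
  · refine ⟨0, w, le_rfl, by simp, ?_, hcr⟩
    rw [zero_smul, envelope_add_zero]
  have hside : ∀ x ∈ envelope a w, (∀ i ∈ tight a w x, ev h (a i) ≤ 0) ∨
      ∀ i ∈ tight a w x, 0 ≤ ev h (a i) := by
    intro x hx
    by_contra! hcon
    exact hcr ⟨x, hx, hcon⟩
  -- Pairs of a vertex and a label strictly beyond the hyperplane from its cell; the slack at such
  -- labels limits the multiple that can be subtracted.
  let R : Set ((ℝ × EuclideanSpace ℝ (Fin d)) × ι) :=
    {q | q.1 ∈ vertices a w ∧ ((0 < ev h (a q.2) ∧ ∀ i ∈ tight a w q.1, ev h (a i) ≤ 0) ∨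
      (ev h (a q.2) < 0 ∧ ∀ i ∈ tight a w q.1, 0 ≤ ev h (a i)))}
  have hRfin : R.Finite :=
    ((finite_vertices a w).prod (Set.toFinite (Set.univ : Set ι))).subset fun q hq => ⟨hq.1, trivial⟩
  have hRne : R.Nonempty := by
    obtain ⟨x, hx⟩ := envelope_nonempty a w
    obtain ⟨y, hy, -⟩ := exists_vertex ha hx
    obtain ⟨i, hi⟩ := hpos
    obtain ⟨j, hj⟩ := hneg
    rcases hside y hy.1 with hs | hs
    · exact ⟨(y, i), hy, Or.inl ⟨hi, hs⟩⟩
    · exact ⟨(y, j), hy, Or.inr ⟨hj, hs⟩⟩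
  obtain ⟨⟨y, k⟩, ⟨hy, hyk⟩, hmin⟩ :=
    Set.exists_min_image R (fun q => (w q.2 - ev q.1 (a q.2)) / |ev h (a q.2)|) hRfin hRne
  set c : ℝ := (w k - ev y (a k)) / |ev h (a k)| with hc
  have hyw := mem_envelope.1 hy.1
  have hc0 : 0 ≤ c := div_nonneg (sub_nonneg.2 (hyw k)) (abs_nonneg _)
  have hkne : 0 < |ev h (a k)| := abs_pos.2 (hyk.elim (fun H => H.1.ne') fun H => H.1.ne)
  have hck : c * |ev h (a k)| = w k - ev y (a k) := div_mul_cancel₀ _ hkne.ne'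
  have hmin' : ∀ q ∈ R, c * |ev h (a q.2)| ≤ w q.2 - ev q.1 (a q.2) := fun q hq => by
    have h0 : 0 < |ev h (a q.2)| := abs_pos.2 (hq.2.elim (fun H => H.1.ne') fun H => H.1.ne)
    exact (le_div_iff₀ h0).1 (hmin q hq)
  have hlow : ∀ x ∈ vertices a w, (∀ i ∈ tight a w x, ev h (a i) ≤ 0) →
      x ∈ envelope a (w - c • posWeight a h) := by
    intro x hx hs
    rw [mem_envelope]
    intro i
    have h1 := mem_envelope.1 hx.1 i
    simp only [Pi.sub_apply, Pi.smul_apply, smul_eq_mul, posWeight]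
    rcases le_or_gt (ev h (a i)) 0 with hi | hi
    · rw [max_eq_right hi]; linarith
    · have h2 := hmin' (x, i) ⟨hx, Or.inl ⟨hi, hs⟩⟩
      simp only [abs_of_pos hi] at h2
      rw [max_eq_left hi.le]
      linarith
  have hhigh : ∀ x ∈ vertices a w, (∀ i ∈ tight a w x, 0 ≤ ev h (a i)) →
      x - c • h ∈ envelope a (w - c • posWeight a h) := by
    intro x hx hs
    rw [mem_envelope]
    intro i
    have h1 := mem_envelope.1 hx.1 i
    simp only [Pi.sub_apply, Pi.smul_apply, smul_eq_mul, posWeight, ev_sub, ev_smul]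
    rcases le_or_gt 0 (ev h (a i)) with hi | hi
    · rw [max_eq_left hi]; linarith
    · have h2 := hmin' (x, i) ⟨hx, Or.inr ⟨hi, hs⟩⟩
      simp only [abs_of_neg hi] at h2
      rw [max_eq_right hi.le]
      linarith
  have hw : w = (w - c • posWeight a h) + c • posWeight a h := by simp
  refine ⟨c, w - c • posWeight a h, hc0, hw, Set.Subset.antisymm ?_ ?_, ?_⟩
  · refine envelope_subset_of_convex ha ((convex_envelope _ _).add (convex_envelope _ _)) ?_ ?_
    · intro x hx
      rcases hside x hx.1 with hs | hs
      · refine ⟨x, hlow x hx hs, 0, mem_envelope.2 fun i => ?_, add_zero x⟩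
        rw [ev_zero]
        exact mul_nonneg hc0 (le_max_right _ _)
      · refine ⟨x - c • h, hhigh x hx hs, c • h, mem_envelope.2 fun i => ?_, sub_add_cancel _ _⟩
        rw [ev_smul]
        exact mul_le_mul_of_nonneg_left (le_max_left _ _) hc0
    · intro x hx z hz
      have := Set.add_mem_add hx hz
      rwa [add_assoc, envelope_add_zero] at this
  · rintro _ ⟨x, hx, z, hz, rfl⟩
    rw [hw]
    exact add_mem_envelope hx hz
  -- The minimizing label `k` becomes tight on the far side. Some tight label is strictly on the
  -- near side, since the spanning cell of `y` cannot lie in the hyperplane.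
  · rcases hyk with ⟨hk, hs⟩ | ⟨hk, hs⟩
    · refine ⟨y, hlow y hy hs, ⟨k, ?_, hk⟩, ?_⟩
      · change ev y (a k) = w k - c * max (ev h (a k)) 0
        rw [abs_of_pos hk] at hck
        rw [max_eq_left hk.le]
        linarith
      · by_contra! hcon
        have hT : ∀ i ∈ tight a w y, ev h (a i) = 0 := fun i hi => by
          refine le_antisymm (hs i hi) (hcon i ?_)
          change ev y (a i) = w i - c * max (ev h (a i)) 0
          rw [max_eq_right (hs i hi), mul_zero, sub_zero]
          exact hi
        rw [hy.2 h hT, ev_zero] at hk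
        exact lt_irrefl _ hk
    · refine ⟨y - c • h, hhigh y hy hs, ?_, k, ?_, hk⟩
      · by_contra! hcon
        have hT : ∀ i ∈ tight a w y, ev h (a i) = 0 := fun i hi => by
          refine le_antisymm (hcon i ?_) (hs i hi)
          change ev (y - c • h) (a i) = w i - c * max (ev h (a i)) 0
          rw [max_eq_left (hs i hi), ev_sub, ev_smul]
          have : ev y (a i) = w i := hi
          rw [this]
        rw [hy.2 h hT, ev_zero] at hk
        exact lt_irrefl _ hk
      · change ev (y - c • h) (a k) = w k - c * max (ev h (a k)) 0
        rw [abs_of_neg hk] at hck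
        rw [max_eq_right hk.le, ev_sub, ev_smul]
        linarith

/-- Fullness and the crossings already obtained survive each further coherent subtraction. -/
lemma exists_coherent_crosses_finset [Finite ι] {κ : Type*} {a : ι → EuclideanSpace ℝ (Fin d)}
    (ha : Spans a Set.univ) {h : κ → ℝ × EuclideanSpace ℝ (Fin d)}
    (hpos : ∀ k, ∃ i, 0 < ev (h k) (a i)) (hneg : ∀ k, ∃ i, ev (h k) (a i) < 0)
    {w : ι → ℝ} (hw : Full a w) (s : Finset κ) :
    ∃ (c : κ → ℝ) (u : ι → ℝ), (∀ k, 0 ≤ c k) ∧ w = u + ∑ k ∈ s, c k • posWeight a (h k) ∧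
      envelope a w = envelope a u + ∑ k ∈ s, envelope a (c k • posWeight a (h k)) ∧
      Full a u ∧ ∀ k ∈ s, Crosses a u (h k) := by
  classical
  induction s using Finset.induction_on with
  | empty => exact ⟨0, w, fun _ => le_rfl, by simp, by simp, hw, by simp⟩
  | insert k s hk ih =>
    obtain ⟨c, u, hc, hwu, henv, hfull, hcr⟩ := ih
    obtain ⟨r, v, hr, huv, henv', hcr'⟩ := exists_coherent_crosses ha u (hpos k) (hneg k)
    have hne : ∀ j ∈ s, Function.update c k r j = c j := fun j hj =>
      Function.update_of_ne (ne_of_mem_of_not_mem hj hk) _ _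
    have hcoh : envelope a (v + r • posWeight a (h k)) =
        envelope a v + envelope a (r • posWeight a (h k)) := by rw [← huv, henv']
    refine ⟨Function.update c k r, v, fun j => ?_, ?_, ?_, ?_, fun j hj => ?_⟩
    · by_cases hj : j = k
      · subst hj; simpa using hr
      · simpa [hj] using hc j
    · rw [Finset.sum_insert hk, Function.update_self, Finset.sum_congr rfl fun j hj => by
        rw [hne j hj], ← add_assoc, ← huv, hwu]
    · rw [Finset.sum_insert hk, Function.update_self, Finset.sum_congr rfl fun j hj => by
        rw [hne j hj], ← add_assoc, ← henv', henv]
    · exact Full.of_coherent hcoh (huv ▸ hfull)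
    · rcases Finset.mem_insert.1 hj with rfl | hj
      · exact hcr'
      · exact Crosses.of_coherent hcoh (huv ▸ hcr j hj)

/-! ### Weights of `1`-splits -/

lemma smul_pointWeight_apply {p : ι} (c : ℝ) (i : ι) [Decidable (i = p)] :
    (c • pointWeight p) i = if i = p then c else 0 := by
  rw [Pi.smul_apply, pointWeight, Set.indicator_apply]
  by_cases h : i = p <;> simp [h]

lemma envelope_smul_pointWeight {a : ι → EuclideanSpace ℝ (Fin d)} {p : ι}
    (hp : a p ∈ hull a {p}ᶜ) {c : ℝ} (hc : 0 ≤ c) :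
    envelope a (c • pointWeight p) = envelope a 0 := by
  classical
  ext x
  simp only [mem_envelope, smul_pointWeight_apply, Pi.zero_apply]
  refine ⟨fun h => ?_, fun h i => (h i).trans (by split_ifs <;> simp [hc])⟩
  have h1 : ∀ i ∈ ({p}ᶜ : Set ι), ev x (a i) ≤ 0 := fun i hi => by
    have h2 := h i
    rwa [if_neg (show i ≠ p from hi)] at h2
  intro i
  by_cases hi : i = p
  · rw [hi]; exact ev_nonpos_of_mem_hull h1 hp
  · exact h1 i hi

lemma add_sum_envelope_pointWeight [Finite ι] {a : ι → EuclideanSpace ℝ (Fin d)} (w : ι → ℝ)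
    {lam : OneSplit a → ℝ} (hlam : ∀ p, 0 ≤ lam p) :
    envelope a w + ∑ p, envelope a (lam p • pointWeight p.1) = envelope a w := by
  have : ∀ s : Finset (OneSplit a),
      envelope a w + ∑ p ∈ s, envelope a (lam p • pointWeight p.1) = envelope a w := by
    intro s
    induction s using Finset.cons_induction with
    | empty => simp
    | cons p s hp ih =>
      rw [Finset.sum_cons, add_left_comm, ih,
        envelope_smul_pointWeight p.2.1.1.mem_hull_compl (hlam p), add_comm, envelope_add_zero]
  exact this _

lemma sum_smul_pointWeight_of_mem [Finite ι] {a : ι → EuclideanSpace ℝ (Fin d)}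
    (lam : OneSplit a → ℝ) (p : OneSplit a) :
    (∑ q, lam q • pointWeight q.1) p.1 = lam p := by
  classical
  rw [Finset.sum_apply, Finset.sum_eq_single p]
  · rw [smul_pointWeight_apply, if_pos rfl]
  · intro q _ hq
    rw [smul_pointWeight_apply, if_neg fun h => hq (Subtype.ext h.symm)]
  · exact fun h => absurd (Finset.mem_univ p) h

lemma sum_smul_pointWeight_of_notMem [Finite ι] {a : ι → EuclideanSpace ℝ (Fin d)}
    (lam : OneSplit a → ℝ) {p : ι} (hp : ¬ IsKSplit a 1 (pointSplit a p)) :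
    (∑ q, lam q • pointWeight q.1) p = 0 := by
  classical
  rw [Finset.sum_apply]
  refine Finset.sum_eq_zero fun q _ => ?_
  have hpq : p ≠ q.1 := fun h => hp (by rw [h]; exact q.2)
  rw [smul_pointWeight_apply, if_neg hpq]

/-- A weight differs from its lower hull only by multiples of the weights of `1`-splits. -/
lemma eq_add_sum_pointWeight [Finite ι] {a : ι → EuclideanSpace ℝ (Fin d)}
    (ha : Spans a Set.univ) {w v : ι → ℝ} (hv : Full a v) (henv : envelope a v = envelope a w) :
    w = v + ∑ p : OneSplit a, (w p.1 - v p.1) • pointWeight p.1 := by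
  ext i
  rw [Pi.add_apply]
  by_cases hi : IsKSplit a 1 (pointSplit a i)
  · have := sum_smul_pointWeight_of_mem (fun p : OneSplit a => w p.1 - v p.1) ⟨i, hi⟩
    simp only at this
    rw [this]; ring
  · rw [sum_smul_pointWeight_of_notMem _ hi, add_zero]
    -- Outside the `1`-splits both weights are attained by minorants in the common envelope, so they
    -- agree.
    obtain ⟨x, hx, hxi⟩ := exists_tight_of_notMem_hull
      (fun h => hi (isKSplit_pointSplit ha h)) w
    obtain ⟨y, hy, hyi⟩ := hv i
    have hxi : ev x (a i) = w i := hxi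
    have hyi : ev y (a i) = v i := hyi
    refine le_antisymm ?_ ?_
    · rw [← henv] at hx
      exact hxi ▸ mem_envelope.1 hx i
    · rw [henv] at hy
      exact hyi ▸ mem_envelope.1 hy i

/-! ### Uniqueness of the decomposition -/

lemma sum_envelope_subset {κ : Type*} [Fintype κ] {a : ι → EuclideanSpace ℝ (Fin d)}
    (u : ι → ℝ) (v : κ → ι → ℝ) :
    envelope a u + ∑ k, envelope a (v k) ⊆ envelope a (u + ∑ k, v k) := by
  rintro _ ⟨x, hx, y, hy, rfl⟩
  obtain ⟨g, hg, rfl⟩ := (Set.mem_fintype_sum _ _).1 hy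
  exact add_mem_envelope hx (sum_mem_envelope hg)

/-- The linear piece of the positive part of `h` that is active at `y`. -/
def activePiece (h : ℝ × EuclideanSpace ℝ (Fin d)) (y : EuclideanSpace ℝ (Fin d)) :
    ℝ × EuclideanSpace ℝ (Fin d) :=
  open Classical in if 0 ≤ ev h y then h else 0

lemma ev_activePiece (h : ℝ × EuclideanSpace ℝ (Fin d)) (y : EuclideanSpace ℝ (Fin d)) :
    ev (activePiece h y) y = max (ev h y) 0 := by
  unfold activePiece
  split_ifs with hy
  · rw [max_eq_left hy]
  · rw [ev_zero, max_eq_right (not_le.1 hy).le]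

lemma smul_activePiece_mem (a : ι → EuclideanSpace ℝ (Fin d))
    (h : ℝ × EuclideanSpace ℝ (Fin d)) (y : EuclideanSpace ℝ (Fin d)) {c : ℝ} (hc : 0 ≤ c) :
    c • activePiece h y ∈ envelope a (c • posWeight a h) := by
  refine mem_envelope.2 fun i => ?_
  rw [ev_smul]
  refine mul_le_mul_of_nonneg_left ?_ hc
  unfold activePiece
  split_ifs
  · exact le_max_left _ _
  · rw [ev_zero]; exact le_max_right _ _

/-- A minorant of a split weight on the labels is one on the whole convex hull. -/
lemma ev_le_of_mem_envelope_posWeight {a : ι → EuclideanSpace ℝ (Fin d)}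
    {h x : ℝ × EuclideanSpace ℝ (Fin d)} {c : ℝ} (hc : 0 ≤ c)
    (hx : x ∈ envelope a (c • posWeight a h)) {y : EuclideanSpace ℝ (Fin d)}
    (hy : y ∈ hull a {i | 0 ≤ ev h (a i)} ∨ y ∈ hull a {i | ev h (a i) ≤ 0}) :
    ev x y ≤ c * max (ev h y) 0 := by
  rw [mem_envelope] at hx
  simp only [Pi.smul_apply, smul_eq_mul, posWeight] at hx
  rcases hy with hy | hy
  · have h1 : ev x y ≤ ev (c • h) y := ev_le_of_mem_hull (fun i hi => by
      have h2 := hx i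
      rwa [max_eq_left hi, ← ev_smul] at h2) hy
    rw [ev_smul] at h1
    exact h1.trans (mul_le_mul_of_nonneg_left (le_max_left _ _) hc)
  · have h1 : ev x y ≤ 0 := ev_nonpos_of_mem_hull (fun i hi => by
      have h2 := hx i
      rwa [max_eq_right hi, mul_zero] at h2) hy
    exact h1.trans (mul_nonneg hc (le_max_right _ _))

/-- At a given label, a tight minorant of `u` plus the active pieces there is a tight minorant of
the sum. -/
lemma Full.add_sum_posWeight {κ : Type*} [Fintype κ] {a : ι → EuclideanSpace ℝ (Fin d)}
    {u : ι → ℝ} (hu : Full a u) (h : κ → ℝ × EuclideanSpace ℝ (Fin d)) {c : κ → ℝ}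
    (hc : ∀ k, 0 ≤ c k) : Full a (u + ∑ k, c k • posWeight a (h k)) := by
  intro i
  obtain ⟨x, hx, hi⟩ := hu i
  have hi : ev x (a i) = u i := hi
  refine ⟨x + ∑ k, c k • activePiece (h k) (a i), add_mem_envelope hx
    (sum_mem_envelope fun k => smul_activePiece_mem a (h k) (a i) (hc k)), ?_⟩
  change ev _ _ = _
  rw [ev_add, ev_sum, hi, Pi.add_apply, Finset.sum_apply]
  simp only [ev_smul, ev_activePiece, Pi.smul_apply, smul_eq_mul, posWeight]

/-- Inside a full-dimensional cell crossed by the hyperplane of `h k`, there is a short segment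
that crosses this hyperplane and none of the others. -/
lemma exists_segment_crossing {κ : Type*} [Finite κ] {a : ι → EuclideanSpace ℝ (Fin d)}
    {T : Set ι} (hT : Spans a T) {h : κ → ℝ × EuclideanSpace ℝ (Fin d)} {k : κ}
    (hk : (h k).2 ≠ 0) (hne : ∀ j ≠ k, ∀ c : ℝ, h j ≠ c • h k)
    (hpos : ∃ i ∈ T, 0 < ev (h k) (a i)) (hneg : ∃ i ∈ T, ev (h k) (a i) < 0) :
    ∃ z v : EuclideanSpace ℝ (Fin d), z ∈ hull a T ∧ z + v ∈ hull a T ∧ z - v ∈ hull a T ∧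
      ev (h k) z = 0 ∧ 0 < ev (h k) (z + v) ∧
      ∀ j ≠ k, (0 ≤ ev (h j) (z + v) ∧ 0 ≤ ev (h j) (z - v)) ∨
        (ev (h j) (z + v) ≤ 0 ∧ ev (h j) (z - v) ≤ 0) := by
  -- Going from an interior point towards a label on the other side, the hyperplane is met in the
  -- interior.
  obtain ⟨z₀, hz₀, hkz₀⟩ : ∃ z₀ ∈ interior (hull a T), ev (h k) z₀ = 0 := by
    obtain ⟨b, hb⟩ := hT.interior_nonempty
    have key : ∀ g : ℝ × EuclideanSpace ℝ (Fin d), 0 < ev g b → (∃ i ∈ T, ev g (a i) < 0) →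
        ∃ z₀ ∈ interior (hull a T), ev g z₀ = 0 := by
      rintro g hgb ⟨j, hj, hgj⟩
      have hD : 0 < ev g b - ev g (a j) := by linarith
      have hst : -ev g (a j) / (ev g b - ev g (a j)) + ev g b / (ev g b - ev g (a j)) = 1 := by
        rw [← add_div, neg_add_eq_sub, div_self hD.ne']
      refine ⟨_, (convex_hull a T).combo_interior_self_mem_interior hb (mem_hull hj)
        (div_pos (neg_pos.2 hgj) hD) (div_pos hgb hD).le hst, ?_⟩
      rw [ev_combo _ _ _ hst]
      ring
    rcases lt_trichotomy (ev (h k) b) 0 with hb0 | hb0 | hb0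
    · obtain ⟨z₀, hz₀, h0⟩ := key (-h k) (by rw [ev_neg]; linarith)
        (by simpa only [ev_neg, Left.neg_neg_iff] using hpos)
      exact ⟨z₀, hz₀, by rwa [ev_neg, neg_eq_zero] at h0⟩
    · exact ⟨b, hb, hb0⟩
    · exact key (h k) hb0 hneg
  -- A direction inside the hyperplane of `h k` and transverse to the others through `z₀`; a small
  -- step along it leaves all of these.
  obtain ⟨v₀, hv₀, hv₀'⟩ : ∃ v₀, inner ℝ v₀ (h k).2 = (0 : ℝ) ∧
      ∀ j ≠ k, ev (h j) z₀ = 0 → inner ℝ v₀ (h j).2 ≠ (0 : ℝ) := by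
    obtain ⟨v₀, hv₀, h0⟩ := Module.Dual.exists_forall_mem_ne_zero_of_forall_exists
      (K := ℝ) (LinearMap.ker (innerₗ (EuclideanSpace ℝ (Fin d)) (h k).2))
      (fun j : {j : κ // j ≠ k ∧ ev (h j) z₀ = 0} =>
        innerₗ (EuclideanSpace ℝ (Fin d)) (h j.1).2) (by
        rintro ⟨j, hj, hj0⟩
        by_contra! hcon
        obtain ⟨c, hc⟩ := exists_eq_smul_of_forall (x := h j) hk hkz₀ fun y hy => by
          have h1 := hcon (y - z₀) (by
            have h2 := ev_add_right (h k) z₀ (y - z₀)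
            rw [add_sub_cancel, hy, hkz₀] at h2
            simp only [LinearMap.mem_ker, innerₗ_apply_apply]
            rw [real_inner_comm]
            linarith)
          simp only [innerₗ_apply_apply] at h1
          have h2 := ev_add_right (h j) z₀ (y - z₀)
          rw [add_sub_cancel, hj0, real_inner_comm, h1] at h2
          simpa using h2
        exact hne j hj c hc)
    refine ⟨v₀, ?_, fun j hj hj0 => ?_⟩
    · rw [real_inner_comm]; exact hv₀
    · rw [real_inner_comm]; exact h0 ⟨j, hj, hj0⟩
  obtain ⟨z, hz, hkz, hjz⟩ : ∃ z ∈ interior (hull a T), ev (h k) z = 0 ∧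
      ∀ j ≠ k, ev (h j) z ≠ 0 := by
    have hlim : Filter.Tendsto (fun t : ℝ => z₀ + t • v₀) (nhdsWithin 0 (Set.Ioi 0))
        (nhds z₀) := by
      have : Continuous fun t : ℝ => z₀ + t • v₀ := by fun_prop
      simpa using (this.tendsto 0).mono_left nhdsWithin_le_nhds
    have h1 : ∀ᶠ t in nhdsWithin (0 : ℝ) (Set.Ioi 0), ∀ j, j ≠ k →
        ev (h j) (z₀ + t • v₀) ≠ 0 := by
      refine Filter.eventually_all.2 fun j => ?_
      by_cases hj0 : ev (h j) z₀ = 0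
      · filter_upwards [self_mem_nhdsWithin] with t ht hj
        rw [ev_add_right, hj0, inner_smul_left, zero_sub]
        exact neg_ne_zero.2 (mul_ne_zero (ne_of_gt ht) (hv₀' j hj hj0))
      · filter_upwards [(((continuous_ev (h j)).tendsto z₀).comp hlim).eventually_ne hj0]
          with t ht _
        exact ht
    obtain ⟨t, ht1, ht2⟩ := (h1.and (hlim.eventually (isOpen_interior.mem_nhds hz₀))).exists
    exact ⟨z₀ + t • v₀, ht2, by rw [ev_add_right, hkz₀, inner_smul_left, hv₀]; simp, ht1⟩
  have hlim : ∀ r : ℝ, Filter.Tendsto (fun t : ℝ => z + (r * t) • (h k).2)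
      (nhdsWithin 0 (Set.Ioi 0)) (nhds z) := fun r => by
    have : Continuous fun t : ℝ => z + (r * t) • (h k).2 := by fun_prop
    simpa using (this.tendsto 0).mono_left nhdsWithin_le_nhds
  have hsgn : ∀ r : ℝ, ∀ᶠ t in nhdsWithin (0 : ℝ) (Set.Ioi 0), ∀ j, j ≠ k →
      0 < ev (h j) z * ev (h j) (z + (r * t) • (h k).2) := by
    intro r
    refine Filter.eventually_all.2 fun j => ?_
    by_cases hj : j = k
    · exact Filter.Eventually.of_forall fun t ht => absurd hj ht
    · have h1 : 0 < ev (h j) z * ev (h j) z := mul_self_pos.2 (hjz j hj)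
      have h2 := ((((continuous_ev (h j)).tendsto z).comp (hlim r)).const_mul
        (ev (h j) z)).eventually (lt_mem_nhds h1)
      filter_upwards [h2] with t ht _
      exact ht
  have hmem : ∀ r : ℝ, ∀ᶠ t in nhdsWithin (0 : ℝ) (Set.Ioi 0),
      z + (r * t) • (h k).2 ∈ hull a T := fun r =>
    (hlim r).eventually (mem_interior_iff_mem_nhds.1 hz)
  obtain ⟨t, ⟨⟨⟨⟨h1, h2⟩, h3⟩, h4⟩, ht⟩⟩ :=
    (((((hmem (-1)).and (hmem 1)).and (hsgn (-1))).and (hsgn 1)).and self_mem_nhdsWithin).exists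
  have ht : 0 < t := ht
  have e1 : z + (-t) • (h k).2 = z + (-1 * t) • (h k).2 := by rw [neg_one_mul]
  have e2 : z - (-t) • (h k).2 = z + (1 * t) • (h k).2 := by rw [neg_smul, sub_neg_eq_add, one_mul]
  -- `ev (h k)` decreases along `(h k).2`, hence the sign of `-t`.
  refine ⟨z, (-t) • (h k).2, interior_subset hz, ?_, ?_, hkz, ?_, fun j hj => ?_⟩
  · rwa [e1]
  · rwa [e2]
  · rw [ev_add_right, hkz, inner_smul_left, zero_sub]
    simp only [RCLike.conj_to_real, neg_mul, neg_neg]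
    exact mul_pos ht (real_inner_self_pos.2 hk)
  · rw [e1, e2]
    have h5 := h3 j hj
    have h6 := h4 j hj
    rcases lt_or_gt_of_ne (hjz j hj) with h7 | h7
    · exact Or.inr ⟨(neg_of_mul_pos_right h5 h7.le).le, (neg_of_mul_pos_right h6 h7.le).le⟩
    · exact Or.inl ⟨((pos_iff_pos_of_mul_pos h5).1 h7).le, ((pos_iff_pos_of_mul_pos h6).1 h7).le⟩

/-- Comparison of the coefficient of one split in two coherent decompositions, the second of
which has a remainder that does not refine this split. -/
lemma coeff_le_of_coherent [Finite ι] {κ : Type*} [Fintype κ]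
    {a : ι → EuclideanSpace ℝ (Fin d)} (ha : Spans a Set.univ)
    {h : κ → ℝ × EuclideanSpace ℝ (Fin d)} (hcov : ∀ k, ∀ y ∈ hull a Set.univ,
      y ∈ hull a {i | 0 ≤ ev (h k) (a i)} ∨ y ∈ hull a {i | ev (h k) (a i) ≤ 0})
    {u u' : ι → ℝ} {c c' : κ → ℝ} (hc : ∀ k, 0 ≤ c k) (hc' : ∀ k, 0 ≤ c' k)
    (hsum : u + ∑ k, c k • posWeight a (h k) = u' + ∑ k, c' k • posWeight a (h k))
    (hcoh : envelope a (u + ∑ k, c k • posWeight a (h k)) =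
      envelope a u + ∑ k, envelope a (c k • posWeight a (h k)))
    (hcoh' : envelope a (u' + ∑ k, c' k • posWeight a (h k)) =
      envelope a u' + ∑ k, envelope a (c' k • posWeight a (h k)))
    {k : κ} (hk : (h k).2 ≠ 0) (hne : ∀ j ≠ k, ∀ r : ℝ, h j ≠ r • h k)
    (hcr : Crosses a u' (h k)) : c k ≤ c' k := by
  obtain ⟨x₁, hx₁, hp, hn⟩ := hcr
  obtain ⟨x', hx', hsub⟩ := exists_vertex ha hx₁
  obtain ⟨z, v, hz, hzv, hzv', hkz, hkv, hj⟩ := exists_segment_crossing hx'.2 hk hne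
    (hp.imp fun i hi => ⟨hsub hi.1, hi.2⟩) (hn.imp fun i hi => ⟨hsub hi.1, hi.2⟩)
  -- Minorants from the first decomposition are resplit by coherence of the second; on the chosen
  -- cell `x'` agrees with `u'` and dominates the resulting minorant of `u'`.
  have hup : ∀ x ∈ envelope a u, ∀ y ∈ hull a (tight a u' x'),
      ev x y + ∑ k, c k * max (ev (h k) y) 0 ≤ ev x' y + ∑ k, c' k * max (ev (h k) y) 0 := by
    intro x hx y hy
    have h1 : x + ∑ k, c k • activePiece (h k) y ∈
        envelope a (u' + ∑ k, c' k • posWeight a (h k)) := by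
      rw [← hsum]
      exact add_mem_envelope hx
        (sum_mem_envelope fun k => smul_activePiece_mem a (h k) y (hc k))
    rw [hcoh'] at h1
    obtain ⟨x₀, hx₀, s, hs, hxs⟩ := h1
    obtain ⟨g, hg, rfl⟩ := (Set.mem_fintype_sum _ _).1 hs
    have h2 : ev x y + ∑ k, c k * max (ev (h k) y) 0 = ev x₀ y + ∑ k, ev (g k) y := by
      have h3 := congrArg (fun x => ev x y) hxs
      simp only [ev_add, ev_sum, ev_smul, ev_activePiece] at h3
      exact h3.symm
    rw [h2]
    refine add_le_add (ev_le_of_mem_hull (fun i hi => ?_) hy) (Finset.sum_le_sum fun k _ => ?_)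
    · have hi : ev x' (a i) = u' i := hi
      rw [hi]
      exact mem_envelope.1 hx₀ i
    · exact ev_le_of_mem_envelope_posWeight (hc' k) (hg k)
        (hcov k y (hull_mono a (Set.subset_univ _) hy))
  -- Coherence of the first decomposition gives the reverse inequality at the midpoint `z`.
  obtain ⟨x, hx, hlow⟩ : ∃ x ∈ envelope a u, ev x' z + ∑ k, c' k * max (ev (h k) z) 0 ≤
      ev x z + ∑ k, c k * max (ev (h k) z) 0 := by
    have h1 : x' + ∑ k, c' k • activePiece (h k) z ∈
        envelope a (u + ∑ k, c k • posWeight a (h k)) := by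
      rw [hsum]
      exact add_mem_envelope hx'.1
        (sum_mem_envelope fun k => smul_activePiece_mem a (h k) z (hc' k))
    rw [hcoh] at h1
    obtain ⟨x₀, hx₀, s, hs, hxs⟩ := h1
    obtain ⟨g, hg, rfl⟩ := (Set.mem_fintype_sum _ _).1 hs
    have h2 : ev x' z + ∑ k, c' k * max (ev (h k) z) 0 = ev x₀ z + ∑ k, ev (g k) z := by
      have h3 := congrArg (fun x => ev x z) hxs
      simp only [ev_add, ev_sum, ev_smul, ev_activePiece] at h3
      exact h3.symm
    refine ⟨x₀, hx₀, ?_⟩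
    rw [h2]
    gcongr with k
    exact ev_le_of_mem_envelope_posWeight (hc k) (hg k)
      (hcov k z (hull_mono a (Set.subset_univ _) hz))
  have h1 := hup x hx _ hzv
  have h2 := hup x hx _ hzv'
  have hmid : ∀ g, ev g (z + v) + ev g (z - v) = 2 * ev g z := fun g => by
    rw [sub_eq_add_neg, ev_add_right, ev_add_right, inner_neg_left]; ring
  have hx2 := hmid x
  have hx'2 := hmid x'
  -- In the second difference along the segment the affine parts cancel; only the term of `k` has a
  -- kink there.
  have hD : ∑ j, (c j - c' j) * (max (ev (h j) (z + v)) 0 + max (ev (h j) (z - v)) 0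
      - 2 * max (ev (h j) z) 0) ≤ 0 := by
    have e : ∑ j, (c j - c' j) * (max (ev (h j) (z + v)) 0 + max (ev (h j) (z - v)) 0
        - 2 * max (ev (h j) z) 0) =
        (∑ j, c j * max (ev (h j) (z + v)) 0 - ∑ j, c' j * max (ev (h j) (z + v)) 0) +
        (∑ j, c j * max (ev (h j) (z - v)) 0 - ∑ j, c' j * max (ev (h j) (z - v)) 0) -
        2 * (∑ j, c j * max (ev (h j) z) 0 - ∑ j, c' j * max (ev (h j) z) 0) := by
      simp only [← Finset.sum_sub_distrib, ← Finset.sum_add_distrib, Finset.mul_sum]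
      exact Finset.sum_congr rfl fun j _ => by ring
    rw [e]
    linarith
  rw [Finset.sum_eq_single k] at hD
  · have h3 := hmid (h k)
    rw [hkz] at h3 hD
    rw [max_eq_left hkv.le, max_eq_right (by linarith : ev (h k) (z - v) ≤ 0), max_self] at hD
    by_contra hcon
    nlinarith [mul_pos (sub_pos.2 (not_le.1 hcon)) hkv]
  · intro j _ hjk
    have h3 := hmid (h j)
    rcases hj j hjk with ⟨h4, h5⟩ | ⟨h4, h5⟩
    · rw [max_eq_left h4, max_eq_left h5, max_eq_left (by linarith)]
      rw [h3]; ring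
    · rw [max_eq_right h4, max_eq_right h5, max_eq_right (by linarith)]
      ring
  · exact fun h => absurd (Finset.mem_univ k) h

/-- The `1`-split terms do not affect the envelope; what is left without them is the lower hull of
`w`, shared by all decompositions. -/
lemma IsSplitDecomposition.lower_hull [Finite ι] {a : ι → EuclideanSpace ℝ (Fin d)}
    (ha : Spans a Set.univ) {side : TwoSplit a → Set ι} {w w₀ : ι → ℝ} {lam : OneSplit a → ℝ}
    {mu : TwoSplit a → ℝ} (D : IsSplitDecomposition a side w w₀ lam mu)
    {h : TwoSplit a → ℝ × EuclideanSpace ℝ (Fin d)}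
    (hw : ∀ S, splitWeight a S.1 (side S) = posWeight a (h S)) :
    Full a (w₀ + ∑ S, mu S • posWeight a (h S)) ∧
      envelope a (w₀ + ∑ S, mu S • posWeight a (h S)) = envelope a w ∧
      envelope a (w₀ + ∑ S, mu S • posWeight a (h S)) =
        envelope a w₀ + ∑ S, envelope a (mu S • posWeight a (h S)) := by
  have hcoh := D.coherent
  have hsum := D.sum_eq
  simp only [hw] at hcoh hsum
  rw [add_sum_envelope_pointWeight _ D.lam_nonneg] at hcoh
  have h1 := sum_envelope_subset (a := a) w₀ fun S => mu S • posWeight a (h S)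
  have h2 : envelope a (w₀ + ∑ S, mu S • posWeight a (h S)) ⊆ envelope a w := by
    intro x hx
    have h3 : (0 : ℝ × EuclideanSpace ℝ (Fin d)) ∈
        envelope a (∑ p, lam p • pointWeight p.1) := by
      refine mem_envelope.2 fun i => ?_
      rw [ev_zero, Finset.sum_apply]
      exact Finset.sum_nonneg fun p _ => mul_nonneg (D.lam_nonneg p)
        (Set.indicator_nonneg (fun _ _ => zero_le_one) i)
    have h4 := add_mem_envelope hx h3
    rwa [add_zero, add_right_comm, ← hsum] at h4
  rw [← hcoh] at h1 ⊢
  exact ⟨((splitPrime_iff ha).1 D.prime).1.add_sum_posWeight h D.mu_nonneg,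
    h2.antisymm h1, h2.antisymm h1⟩

end PointConfig

end

/-! ### The decomposition theorem -/

open PointConfig in
theorem mainTheorem7 {d : ℕ} {ι : Type*} [Finite ι] (a : ι → EuclideanSpace ℝ (Fin d))
    (ha : affineSpan ℝ (Set.range a) = ⊤)
    (side : PointConfig.TwoSplit a → Set ι)
    (hside : ∀ S, side S ∈ PointConfig.maximalFaces S.1)
    (w : ι → ℝ) :
    ∃! D : (ι → ℝ) × (PointConfig.OneSplit a → ℝ) × (PointConfig.TwoSplit a → ℝ),
      PointConfig.IsSplitDecomposition a side w D.1 D.2.1 D.2.2 := by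
  have hs := spans_univ ha
  choose h H hP using fun S : TwoSplit a => S.2.exists_isSplitFunctional_side hs (hside S)
  have hw : ∀ S, splitWeight a S.1 (side S) = posWeight a (h S) := fun S => by
    rw [hP S, (H S).splitWeight_eq]
    rfl
  have hne : ∀ S T : TwoSplit a, T ≠ S → ∀ c : ℝ, h T ≠ c • h S := fun S T hTS c hc =>
    hTS (Subtype.ext ((H S).eq_of_smul (H T) hc).symm)
  have hh : ∀ S, (h S).2 ≠ 0 := fun S h0 => by
    have := (H S).norm_eq
    simp [h0] at this
  obtain ⟨v, hv, henv, hle⟩ := exists_full_envelope_eq hs w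
  refine existsUnique_of_exists_of_unique ?_ ?_
  · obtain ⟨c, u, hc, hvu, hcoh, hfull, hcr⟩ := exists_coherent_crosses_finset hs
      (fun S => (H S).exists_pos) (fun S => (H S).exists_neg) hv Finset.univ
    refine ⟨(u, fun p => w p.1 - v p.1, c), fun p => sub_nonneg.2 (hle p.1), hc, ?_, ?_, ?_⟩
    · refine (splitPrime_iff hs).2 ⟨hfull, fun S g hS G => ?_⟩
      -- The given functional `g` may differ from the chosen `h`, but crossing depends only on the
      -- split, through non-refinement.
      exact G.not_refines_iff.1
        ((H ⟨S, hS⟩).not_refines_iff.2 (hcr ⟨S, hS⟩ (Finset.mem_univ _)))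
    · simp only [hw]
      rw [add_right_comm, ← hvu]
      exact eq_add_sum_pointWeight hs hv henv
    · simp only [hw]
      rw [add_sum_envelope_pointWeight _ fun p => sub_nonneg.2 (hle p.1), ← hcoh, henv]
  · rintro ⟨u, lam, mu⟩ ⟨u', lam', mu'⟩ D D'
    obtain ⟨hf, he, hcoh⟩ := D.lower_hull hs hw
    obtain ⟨hf', he', hcoh'⟩ := D'.lower_hull hs hw
    have hsum := hf.eq_of_envelope_eq hf' (he.trans he'.symm)
    have hcr := fun S : TwoSplit a => ((splitPrime_iff hs).1 D.prime).2 S.1 (h S) S.2 (H S)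
    have hcr' := fun S : TwoSplit a => ((splitPrime_iff hs).1 D'.prime).2 S.1 (h S) S.2 (H S)
    obtain rfl : mu = mu' := funext fun S => le_antisymm
      (coeff_le_of_coherent hs (fun S => (H S).cover) D.mu_nonneg D'.mu_nonneg hsum hcoh hcoh'
        (hh S) (hne S) (hcr' S))
      (coeff_le_of_coherent hs (fun S => (H S).cover) D'.mu_nonneg D.mu_nonneg hsum.symm hcoh' hcoh
        (hh S) (hne S) (hcr S))
    obtain rfl : u = u' := add_right_cancel hsum
    have hlam : ∑ p, lam p • pointWeight p.1 = ∑ p, lam' p • pointWeight p.1 :=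
      add_left_cancel (add_right_cancel (D.sum_eq.symm.trans D'.sum_eq))
    obtain rfl : lam = lam' := funext fun p => by
      rw [← sum_smul_pointWeight_of_mem lam p, hlam, sum_smul_pointWeight_of_mem]
    rfl
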